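/- Let $d\ge 1$, let $\Omega\subset\mathbb{R}^d$ be a bounded open set with $C^1$ boundary (near each boundary point, after a rigid motion, $\Omega$ is the region above the graph of a $C^1$ function), let $\nu$ be its outward unit normal and $\sigma$ the surface measure on $\partial\Omega$. Let $T>0$, $Q=\Omega\times(0,T)$ and $0<\alpha<1$. Put $\gamma=\frac{\alpha}{1-\alpha}$, $B(\alpha)=(1-\alpha)+\frac{\alpha}{\Gamma(\alpha)}$, and let $$E_\alpha(z)=\sum_{k=0}^\infty\frac{z^k}{\Gamma(k\alpha+1)}$$ be the Mittag-Leffler function $E_{\alpha,1}$. For functions $u$ on $[0,T]$ let $${}^{ABC}_{\ \ \ 0}D^\alpha_t u(t)=\frac{B(\alpha)}{1-\alpha}\int_0^t u'(\tau)\,E_\alpha\big[-\gamma(t-\tau)^\alpha\big]\,d\tau,\qquad {}^{ABC}_{\ \ \ T}D^\alpha_t u(t)=-\frac{B(\alpha)}{1-\alpha}\int_t^T u'(\tau)\,E_\alpha\big[-\gamma(\tau-t)^\alpha\big]\,d\tau$$ be the left and right Atangana–Baleanu derivatives of order $\alpha$ in the Caputo sense, taken in the time variable for functions of $(x,t)$.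 Then for all $y,\varphi\in C^\infty(\overline{Q})$, $$\begin{aligned} \int_\Omega\int_0^T\big({}^{ABC}_{\ \ \ 0}D^\alpha_t y-\Delta y\big)\varphi\,dt\,dx ={}&\int_0^T\int_{\partial\Omega}y\,\frac{\partial\varphi}{\partial\nu}\,d\sigma\,dt-\int_0^T\int_{\partial\Omega}\varphi\,\frac{\partial y}{\partial\nu}\,d\sigma\,dt +\int_\Omega\int_0^T y\,\big({}^{ABC}_{\ \ \ T}D^\alpha_t\varphi-\Delta\varphi\big)\,dt\,dx\\ &-\frac{B(\alpha)}{1-\alpha}\int_\Omega\int_0^T y(x,0)\,E_\alpha[-\gamma t^\alpha]\,\varphi(x,t)\,dt\,dx\\ &+\frac{B(\alpha)}{1-\alpha}\int_\Omega\varphi(x,T)\int_0^T y(x,t)\,E_\alpha\big[-\gamma(T-t)^\alpha\big]\,dt\,dx. \end{aligned}$$ -/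

import Mathlib

open MeasureTheory Set Filter Topology
open scoped ContDiff

noncomputable section

/-- The two-parameter Mittag-Leffler function `E_{α,β}(z) = ∑_{k ≥ 0} z^k / Γ(kα + β)`
at a real argument. -/
def mittagLeffler (α β z : ℝ) : ℝ :=
  ∑' k : ℕ, z ^ k / Real.Gamma (k * α + β)

/-- The normalization `B(α) = (1 - α) + α / Γ(α)`. -/
def abNorm (α : ℝ) : ℝ := (1 - α) + α / Real.Gamma α

/-- The Mittag-Leffler kernel `s ↦ E_α(-γ s^α)`, with `E_α = E_{α,1}` and `γ = α / (1 - α)`. -/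
def abKernel (α s : ℝ) : ℝ := mittagLeffler α 1 (-(α / (1 - α)) * s ^ α)

/-- The Atangana-Baleanu derivative of order `α` in the Caputo sense with base point `a`:
`B(α)/(1-α) ∫_a^t u'(τ) E_α(-γ (t-τ)^α) dτ`. -/
def abcLeft (α a : ℝ) (u : ℝ → ℝ) (t : ℝ) : ℝ :=
  abNorm α / (1 - α) * ∫ τ in a..t, deriv u τ * abKernel α (t - τ)

/-- The Atangana-Baleanu derivative of order `α` in the Caputo sense with (right) base point `T`:
`-B(α)/(1-α) ∫_t^T u'(τ) E_α(-γ (τ-t)^α) dτ`. -/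
def abcRight (α T : ℝ) (u : ℝ → ℝ) (t : ℝ) : ℝ :=
  -(abNorm α / (1 - α)) * ∫ τ in t..T, deriv u τ * abKernel α (τ - t)

/-- The set `Ω` has `C^1` boundary: near each boundary point there are a unit vector `e` and a
`C^1` function `g` such that `Ω` is exactly the part above the graph of `g` over the hyperplane
orthogonal to `e` (here `x - ⟪e, x⟫ e` is the orthogonal projection of `x` to that hyperplane). -/
def HasC1Boundary {d : ℕ} (Ω : Set (EuclideanSpace ℝ (Fin d))) : Prop :=
  ∀ x₀ ∈ frontier Ω, ∃ r > (0 : ℝ), ∃ e : EuclideanSpace ℝ (Fin d), ‖e‖ = 1 ∧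
    ∃ g : EuclideanSpace ℝ (Fin d) → ℝ, ContDiff ℝ 1 g ∧
      ∀ x ∈ Metric.ball x₀ r, x ∈ Ω ↔ g (x - inner ℝ e x • e) < inner ℝ e x

/-- `ν` is an outward unit normal of `Ω` at the boundary point `x`: it has length one, is
orthogonal to the tangent vectors of the boundary at `x`, and points out of `Ω`. -/
def IsOutwardUnitNormal {d : ℕ} (Ω : Set (EuclideanSpace ℝ (Fin d)))
    (x ν : EuclideanSpace ℝ (Fin d)) : Prop :=
  ‖ν‖ = 1 ∧ (∀ v ∈ tangentConeAt ℝ (frontier Ω) x, inner ℝ v ν = 0) ∧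
    ∀ᶠ s : ℝ in 𝓝[>] 0, x + s • ν ∉ closure Ω

open Classical in
/-- The outward unit normal field on the boundary of `Ω` (for a set with `C^1` boundary there is
exactly one outward unit normal at each boundary point). -/
def outwardNormal {d : ℕ} (Ω : Set (EuclideanSpace ℝ (Fin d)))
    (x : EuclideanSpace ℝ (Fin d)) : EuclideanSpace ℝ (Fin d) :=
  if h : ∃ ν, IsOutwardUnitNormal Ω x ν then h.choose else 0

/-- The outward normal derivative at the boundary point `x` of a function on the closure
of `Ω`. -/
def normalDeriv {d : ℕ} (Ω : Set (EuclideanSpace ℝ (Fin d)))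
    (f : EuclideanSpace ℝ (Fin d) → ℝ) (x : EuclideanSpace ℝ (Fin d)) : ℝ :=
  fderivWithin ℝ f (closure Ω) x (outwardNormal Ω x)

/-- The surface measure on the boundary of `Ω`: the `(d-1)`-dimensional Hausdorff measure on
`∂Ω`, normalized so that it agrees with Lebesgue measure in dimension `d - 1`. -/
def surfaceMeasure {d : ℕ} (Ω : Set (EuclideanSpace ℝ (Fin d))) :
    Measure (EuclideanSpace ℝ (Fin d)) :=
  (Measure.euclideanHausdorffMeasure (d - 1)).restrict (frontier Ω)

end

/-!
The formula splits into a statement about the Laplacian, which is Green's second identity on `Ω`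
integrated over time, and a statement about the fractional derivative, which is an integration by
parts in time at each fixed `x ∈ Ω`.

*Green's identity* follows from the divergence theorem `HasC1Boundary.setIntegral_fderiv_eq`:
`∫_Ω ∂_v f = ∫_∂Ω f ⟪v, ν⟫ dσ` for `f` continuous on the closure of `Ω` and of class `C^1` with
bounded derivative inside. A smooth partition of unity reduces it to functions supported inside
`Ω`, where both sides vanish, or supported in a ball where `Ω` is the region above the graph of a
`C^1` function `g` in a direction `e`. There the shear `(h, s) ↦ h + (g(h) + s) e` preserves volume
and straightens the region to a half-space. Derivatives along the slices `s = const` integrate to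
zero, and the fundamental theorem of calculus in `s` leaves `∫ f(h + g(h) e) ⟪v, ∇g(h) - e⟫ dh`
(`setIntegral_fderiv_epigraph`). This is the surface integral, because the outward unit normal is
`∇g - e` divided by its length (`IsGraphPatch.outwardNormal_eq`), and this length is also the
density of the Hausdorff measure of the graph (`comap_graphMap_euclideanHausdorffMeasure`).
The area formula needed for the latter compares the graph map with its derivative on small sets,
where they distort distances by factors close to one; for linear maps the formula is the
determinant formula for Hausdorff measures.

*The fractional part* uses only that the kernel `k(s) = E_α(-γ s^α)` is continuous
(`continuous_abKernel`). Writing the left derivative as `∫_0^t u'(t - s) k(s) ds` and exchanging the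
integrals over the triangle `s ≤ t`, what remains for each lag `s` is ordinary integration by parts
of `w(t) u'(t - s)` on `[s, T]` (`integral_conv_deriv_mul`). The boundary terms at `t = T` and at
`t = s` are the two kernel integrals in the formula.

To exchange integrals freely, all integrands on the cylinder are replaced by continuous functions
on the whole space-time, obtained from Tietze's theorem on the closed cylinder
(`CylinderExtension`).
-/

/-! ### Coordinates straightening a graph -/

/-- The graph map `h ↦ h + g(h) e` from the hyperplane orthogonal to `e`. -/
noncomputable def graphMap {d : ℕ} (e : EuclideanSpace ℝ (Fin d)) (g : EuclideanSpace ℝ (Fin d) → ℝ)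
    (h : (ℝ ∙ e)ᗮ) : EuclideanSpace ℝ (Fin d) := (h : EuclideanSpace ℝ (Fin d)) + g h • e

/-- The coordinates `(h, s) ↦ h + (g(h) + s) e`, in which the graph of `g` is `{s = 0}` and the
region above it is `{s > 0}`. -/
noncomputable def graphChart {d : ℕ} (e : EuclideanSpace ℝ (Fin d))
    (g : EuclideanSpace ℝ (Fin d) → ℝ) (p : (ℝ ∙ e)ᗮ × ℝ) : EuclideanSpace ℝ (Fin d) :=
  (p.1 : EuclideanSpace ℝ (Fin d)) + (g p.1 + p.2) • e

section Chart

variable {d : ℕ} {e : EuclideanSpace ℝ (Fin d)} {g : EuclideanSpace ℝ (Fin d) → ℝ}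

lemma inner_orthogonal_span (h : (ℝ ∙ e)ᗮ) : inner ℝ e (h : EuclideanSpace ℝ (Fin d)) = 0 :=
  Submodule.mem_orthogonal_singleton_iff_inner_right.1 h.2

/-- The projection `x ↦ x - ⟪e, x⟫ e` onto the hyperplane orthogonal to the unit vector `e`. -/
noncomputable def hyperplaneProj (he : ‖e‖ = 1) : EuclideanSpace ℝ (Fin d) →L[ℝ] (ℝ ∙ e)ᗮ :=
  (ContinuousLinearMap.id ℝ _ - (innerSL ℝ e).smulRight e).codRestrict _ fun x => by
    rw [Submodule.mem_orthogonal_singleton_iff_inner_right]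
    simp [inner_sub_right, inner_smul_right, he]

@[simp] lemma coe_hyperplaneProj (he : ‖e‖ = 1) (x : EuclideanSpace ℝ (Fin d)) :
    (hyperplaneProj he x : EuclideanSpace ℝ (Fin d)) = x - inner ℝ e x • e := by
  simp [hyperplaneProj]

lemma inner_graphChart (he : ‖e‖ = 1) (p : (ℝ ∙ e)ᗮ × ℝ) :
    inner ℝ e (graphChart e g p) = g p.1 + p.2 := by
  simp [graphChart, inner_add_right, inner_smul_right, inner_orthogonal_span, he]

lemma hyperplaneProj_graphChart (he : ‖e‖ = 1) (p : (ℝ ∙ e)ᗮ × ℝ) :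
    hyperplaneProj he (graphChart e g p) = p.1 := by
  ext1
  rw [coe_hyperplaneProj, inner_graphChart he]
  simp [graphChart]

/-- `graphChart` as a homeomorphism. -/
noncomputable def graphHomeo (he : ‖e‖ = 1) (hg : Continuous g) :
    (ℝ ∙ e)ᗮ × ℝ ≃ₜ EuclideanSpace ℝ (Fin d) where
  toFun := graphChart e g
  invFun x := (hyperplaneProj he x, inner ℝ e x - g (hyperplaneProj he x))
  left_inv p := by
    ext1
    · exact hyperplaneProj_graphChart he p
    · simp only [hyperplaneProj_graphChart, inner_graphChart he]; ring
  right_inv x := by simp [graphChart]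
  continuous_toFun := by unfold graphChart; fun_prop
  continuous_invFun := by fun_prop

lemma finrank_hyperplane (he : ‖e‖ = 1) : Module.finrank ℝ (ℝ ∙ e)ᗮ = d - 1 := by
  have h := (ℝ ∙ e).finrank_add_finrank_orthogonal
  rw [finrank_span_singleton (by intro h; simp [h] at he), finrank_euclideanSpace_fin] at h
  omega

/-- The coordinates straightening a graph preserve volume. -/
lemma measurePreserving_graphChart (he : ‖e‖ = 1) (hg : Continuous g) :
    MeasurePreserving (graphChart e g) := by
  have he0 : e ≠ 0 := by intro h; simp [h] at he
  let S := (ℝ ∙ e)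
  have h2 := (S.measurePreserving_measurableEquivProd (0 : EuclideanSpace ℝ (Fin d))).symm
  rw [InnerProductSpace.euclideanHausdorffMeasure_eq_volume] at h2
  let c : ℝ → S := fun t => t • ⟨e, Submodule.mem_span_singleton_self e⟩
  have hc : MeasurePreserving c := by
    refine ⟨by fun_prop, ?_⟩
    have := volume_eq_of_finrank_eq_one (finrank_span_singleton (K := ℝ) he0)
      (v := ⟨e, Submodule.mem_span_singleton_self e⟩) (by simpa using he0)
    rw [this]
    have hn : ‖(⟨e, Submodule.mem_span_singleton_self e⟩ : S)‖ₑ = 1 := by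
      rw [← ofReal_norm]; simp [he]
    rw [hn, one_smul]
  have h3 : MeasurePreserving (fun p : (ℝ ∙ e)ᗮ × ℝ => (p.1, g p.1 + p.2))
      (volume.prod volume) (volume.prod volume) :=
    (MeasurePreserving.id volume).skew_product
      (g := fun (h : (ℝ ∙ e)ᗮ) (s : ℝ) => g h + s) (by unfold Function.uncurry; fun_prop)
      (ae_of_all _ fun a => map_add_left_eq_self _ _)
  have h4 := h2.comp ((hc.prod (MeasurePreserving.id (volume : Measure (ℝ ∙ e)ᗮ))).comp
    ((Measure.measurePreserving_swap (μ := (volume : Measure (ℝ ∙ e)ᗮ))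
      (ν := (volume : Measure ℝ))).comp h3))
  have h5 : graphChart e g = (S.measurableEquivProd (0 : EuclideanSpace ℝ (Fin d))).symm ∘
      Prod.map c id ∘ Prod.swap ∘ fun p : (ℝ ∙ e)ᗮ × ℝ => (p.1, g p.1 + p.2) := by
    ext1 p
    simp only [graphChart, Function.comp_apply, Submodule.measurableEquivProd_symm_apply,
      Prod.swap, Prod.map, c]
    simp [add_comm]
  rw [h5]
  exact h4

end Chart

/-! ### Integration above a graph -/

section Epigraph

/-- The integral of a directional derivative of a compactly supported `C^1` function vanishes. -/
lemma integral_fderiv_apply_eq_zero {F : Type*} [NormedAddCommGroup F] [NormedSpace ℝ F]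
    [FiniteDimensional ℝ F] [MeasurableSpace F] [BorelSpace F] (μ : Measure F)
    [μ.IsAddHaarMeasure] {f : F → ℝ} (hf : ContDiff ℝ 1 f) (hc : HasCompactSupport f) (v : F) :
    ∫ x, fderiv ℝ f x v ∂μ = 0 := by
  have h1 : Continuous fun x => fderiv ℝ f x v := (hf.continuous_fderiv one_ne_zero).clm_apply
    continuous_const
  have h2 : HasCompactSupport fun x => fderiv ℝ f x v := hc.fderiv_apply ℝ v
  have := integral_mul_fderiv_eq_neg_fderiv_mul_of_integrable (μ := μ) (v := v)
    (f := fun _ : F => (1 : ℝ)) (g := f) (by simp)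
    (by simpa using h1.integrable_of_hasCompactSupport h2)
    (by simpa using hf.continuous.integrable_of_hasCompactSupport hc)
    (fun x _ => by fun_prop) (fun x _ => hf.differentiable one_ne_zero x)
  simpa using this

/-- A function on a measurable set `U` which is continuous, vanishes off a compact set `K` and is
bounded on `U ∩ K` is integrable on `U`. -/
lemma integrableOn_of_continuousOn_of_bounded {X : Type*} [TopologicalSpace X]
    [T2Space X] [MeasurableSpace X] [OpensMeasurableSpace X] {μ : Measure X}
    [IsFiniteMeasureOnCompacts μ] {U K : Set X} (hU : MeasurableSet U)
    (hK : IsCompact K) {F : X → ℝ} (hF : ContinuousOn F U) (hz : ∀ x ∈ U, x ∉ K → F x = 0)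
    {C : ℝ} (hb : ∀ x ∈ U, x ∈ K → ‖F x‖ ≤ C) : IntegrableOn F U μ := by
  have hUK := hU.inter hK.measurableSet
  have h1 : IntegrableOn F (U ∩ K) μ := by
    have : IsFiniteMeasure (μ.restrict (U ∩ K)) :=
      ⟨by simpa using (measure_mono inter_subset_right).trans_lt hK.measure_lt_top⟩
    refine Integrable.of_bound ((hF.mono inter_subset_left).aestronglyMeasurable hUK) C ?_
    exact (ae_restrict_iff' hUK).2 (ae_of_all _ fun x hx => hb x hx.1 hx.2)
  exact h1.of_forall_sdiff_eq_zero hU fun x hx => hz x hx.1 fun hxK => hx.2 ⟨hx.1, hxK⟩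

variable {d : ℕ} {e : EuclideanSpace ℝ (Fin d)} {g : EuclideanSpace ℝ (Fin d) → ℝ}

/-- The open region above the graph of `g` in the direction `e`. -/
def epigraph {d : ℕ} (e : EuclideanSpace ℝ (Fin d)) (g : EuclideanSpace ℝ (Fin d) → ℝ) :
    Set (EuclideanSpace ℝ (Fin d)) := {x | g (x - inner ℝ e x • e) < inner ℝ e x}

lemma isOpen_epigraph (hg : Continuous g) : IsOpen (epigraph e g) :=
  isOpen_lt (by fun_prop) (by fun_prop)

lemma graphChart_mem_epigraph (he : ‖e‖ = 1) (p : (ℝ ∙ e)ᗮ × ℝ) :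
    graphChart e g p ∈ epigraph e g ↔ 0 < p.2 := by
  have := coe_hyperplaneProj he (graphChart e g p)
  rw [hyperplaneProj_graphChart] at this
  change g _ < inner ℝ e _ ↔ _
  rw [← this, inner_graphChart he]
  exact lt_add_iff_pos_right _

lemma graphChart_zero (h : (ℝ ∙ e)ᗮ) : graphChart e g (h, 0) = graphMap e g h := by
  simp [graphChart, graphMap]

/-- The derivative of `h ↦ h + (g(h) + s) e` along the hyperplane. -/
noncomputable def graphDeriv {d : ℕ} (e : EuclideanSpace ℝ (Fin d))
    (g : EuclideanSpace ℝ (Fin d) → ℝ) (h : (ℝ ∙ e)ᗮ) :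
    (ℝ ∙ e)ᗮ →L[ℝ] EuclideanSpace ℝ (Fin d) :=
  (ℝ ∙ e)ᗮ.subtypeL + ((fderiv ℝ g h).comp (ℝ ∙ e)ᗮ.subtypeL).smulRight e

lemma graphDeriv_apply (h w : (ℝ ∙ e)ᗮ) :
    graphDeriv e g h w = (w : EuclideanSpace ℝ (Fin d)) + fderiv ℝ g h w • e := by
  simp [graphDeriv]

lemma hasStrictFDerivAt_graphChart_left (hg : ContDiff ℝ 1 g) (h : (ℝ ∙ e)ᗮ) (s : ℝ) :
    HasStrictFDerivAt (fun h => graphChart e g (h, s)) (graphDeriv e g h) h := by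
  unfold graphChart graphDeriv
  have h1 : HasStrictFDerivAt g (fderiv ℝ g h) (h : EuclideanSpace ℝ (Fin d)) :=
    hg.contDiffAt.hasStrictFDerivAt one_ne_zero
  have h2 : HasStrictFDerivAt (fun h : (ℝ ∙ e)ᗮ => (h : EuclideanSpace ℝ (Fin d)))
    (ℝ ∙ e)ᗮ.subtypeL h := (ℝ ∙ e)ᗮ.subtypeL.hasStrictFDerivAt
  exact h2.add (((h1.comp h h2).add_const s).smul_const e)

lemma contDiff_graphChart_left (hg : ContDiff ℝ 1 g) (s : ℝ) :
    ContDiff ℝ 1 (fun h : (ℝ ∙ e)ᗮ => graphChart e g (h, s)) := by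
  unfold graphChart
  have h2 : ContDiff ℝ 1 (fun h : (ℝ ∙ e)ᗮ => (h : EuclideanSpace ℝ (Fin d))) :=
    (ℝ ∙ e)ᗮ.subtypeL.contDiff
  exact h2.add (((hg.comp h2).add contDiff_const).smul contDiff_const)

lemma hasDerivAt_graphChart_right (h : (ℝ ∙ e)ᗮ) (s : ℝ) :
    HasDerivAt (fun s => graphChart e g (h, s)) e s := by
  unfold graphChart
  simpa using (((hasDerivAt_id s).const_add (g h)).smul_const e).const_add
    (h : EuclideanSpace ℝ (Fin d))

lemma isClosedEmbedding_graphChart_left (he : ‖e‖ = 1) (hg : Continuous g) (s : ℝ) :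
    IsClosedEmbedding (fun h : (ℝ ∙ e)ᗮ => graphChart e g (h, s)) :=
  (graphHomeo he hg).isClosedEmbedding.comp
    (Function.LeftInverse.isClosedEmbedding (f := Prod.fst) (fun _ => rfl)
      continuous_fst (Continuous.prodMk_left s))

lemma isClosedEmbedding_graphMap (he : ‖e‖ = 1) (hg : Continuous g) :
    IsClosedEmbedding (graphMap e g) := by
  simpa [graphChart_zero] using isClosedEmbedding_graphChart_left he hg 0

lemma isClosedEmbedding_graphChart_right (he : ‖e‖ = 1) (hg : Continuous g) (h : (ℝ ∙ e)ᗮ) :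
    IsClosedEmbedding (fun s : ℝ => graphChart e g (h, s)) :=
  (graphHomeo he hg).isClosedEmbedding.comp
    (Function.LeftInverse.isClosedEmbedding (f := Prod.snd) (fun _ => rfl)
      continuous_snd (Continuous.prodMk_right h))

/-- The divergence theorem above a graph, for the field `f v`: in straightened coordinates the
tangential part of `v` differentiates `f` along slices `s = const`, where the integral vanishes,
and the remaining multiple of `e` is integrated in `s`. -/
theorem setIntegral_fderiv_epigraph (he : ‖e‖ = 1) (hg : ContDiff ℝ 1 g)
    {f : EuclideanSpace ℝ (Fin d) → ℝ} (hf : Continuous f) (hfs : HasCompactSupport f)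
    (hfd : ContDiffOn ℝ 1 f (epigraph e g)) {C : ℝ}
    (hC : ∀ x ∈ epigraph e g, ‖fderiv ℝ f x‖ ≤ C) (v : EuclideanSpace ℝ (Fin d)) :
    ∫ x in epigraph e g, fderiv ℝ f x v =
      ∫ h, f (graphMap e g h) * (fderiv ℝ g h (hyperplaneProj he v) - inner ℝ e v) := by
  have hgc := hg.continuous
  have hRo := isOpen_epigraph (e := e) hgc
  set R := epigraph e g with hR
  set S := graphChart e g with hS
  have hSc : Continuous S := (graphHomeo he hgc).continuous
  have hgd : Continuous fun p : (ℝ ∙ e)ᗮ × ℝ => fderiv ℝ g (p.1 : EuclideanSpace ℝ (Fin d)) :=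
    (hg.continuous_fderiv one_ne_zero).comp (by fun_prop)
  set U : Set ((ℝ ∙ e)ᗮ × ℝ) := univ ×ˢ Ioi 0 with hU
  have hUR : S ⁻¹' R = U := by
    ext p
    simp [hS, hR, graphChart_mem_epigraph he, hU]
  have hUm : MeasurableSet U := MeasurableSet.univ.prod measurableSet_Ioi
  have hKc : IsCompact (S ⁻¹' tsupport f) :=
    (graphHomeo he hgc).isClosedEmbedding.isCompact_preimage hfs
  have hA : ContinuousOn (fun p => fderiv ℝ f (S p)) U :=
    (hfd.continuousOn_fderiv_of_isOpen hRo le_rfl).comp hSc.continuousOn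
      (fun p hp => by rw [← hUR] at hp; exact hp)
  -- integrability of `p ↦ Df(S p)(W p)` on the straightened region, for a continuous field `W`
  have hint : ∀ W : (ℝ ∙ e)ᗮ × ℝ → EuclideanSpace ℝ (Fin d), Continuous W →
      IntegrableOn (fun p => fderiv ℝ f (S p) (W p)) U := by
    intro W hW
    obtain ⟨M, hM⟩ := hKc.exists_bound_of_continuousOn hW.continuousOn
    refine integrableOn_of_continuousOn_of_bounded hUm hKc (hA.clm_apply hW.continuousOn)
      (C := C * M) ?_ ?_
    · intro p _ hp
      have : fderiv ℝ f (S p) = 0 := by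
        by_contra h
        exact hp (support_fderiv_subset ℝ h)
      simp [this]
    · intro p hp hpK
      have h1 := hC (S p) (by rw [← hUR] at hp; exact hp)
      exact (ContinuousLinearMap.le_opNorm _ _).trans
        (mul_le_mul h1 (hM p hpK) (norm_nonneg _) ((norm_nonneg _).trans h1))
  have hrestr : (volume : Measure ((ℝ ∙ e)ᗮ × ℝ)).restrict U =
      (volume : Measure (ℝ ∙ e)ᗮ).prod (volume.restrict (Ioi (0 : ℝ))) := by
    rw [hU, Measure.volume_eq_prod, ← Measure.prod_restrict, Measure.restrict_univ]
  set w := hyperplaneProj he v with hw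
  set c : (ℝ ∙ e)ᗮ → ℝ := fun h => fderiv ℝ g h w - inner ℝ e v with hc
  have hcc : Continuous c := by
    have : Continuous fun h : (ℝ ∙ e)ᗮ => fderiv ℝ g (h : EuclideanSpace ℝ (Fin d)) :=
      (hg.continuous_fderiv one_ne_zero).comp (by fun_prop)
    fun_prop
  have hdec : ∀ p, fderiv ℝ f (S p) v =
      fderiv ℝ f (S p) (graphDeriv e g p.1 w) - fderiv ℝ f (S p) (c p.1 • e) := by
    intro p
    rw [← map_sub]
    congr 1
    rw [graphDeriv_apply, hw, coe_hyperplaneProj]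
    simp only [hc, hw, coe_hyperplaneProj]
    module
  have hW1 : Continuous fun p : (ℝ ∙ e)ᗮ × ℝ => graphDeriv e g p.1 w := by
    simp only [graphDeriv_apply]
    fun_prop
  have hW2 : Continuous fun p : (ℝ ∙ e)ᗮ × ℝ => c p.1 • e := by fun_prop
  have hI1 := hint _ hW1
  have hI2 := hint _ hW2
  have htan : ∫ p in U, fderiv ℝ f (S p) (graphDeriv e g p.1 w) = 0 := by
    rw [IntegrableOn, hrestr] at hI1
    rw [hrestr, integral_prod_symm _ hI1]
    refine (setIntegral_congr_fun measurableSet_Ioi (g := fun _ => 0) fun s hs => ?_).trans (by simp)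
    have hmem : ∀ h : (ℝ ∙ e)ᗮ, S (h, s) ∈ R := fun h =>
      (graphChart_mem_epigraph he (h, s)).2 hs
    have hd1 : ContDiff ℝ 1 (fun h : (ℝ ∙ e)ᗮ => f (S (h, s))) := by
      rw [← contDiffOn_univ]
      exact hfd.comp (contDiff_graphChart_left hg s).contDiffOn fun h _ => hmem h
    have hd2 : ∀ h, fderiv ℝ (fun h : (ℝ ∙ e)ᗮ => f (S (h, s))) h w =
        fderiv ℝ f (S (h, s)) (graphDeriv e g h w) := by
      intro h
      have h1 : HasFDerivAt f (fderiv ℝ f (S (h, s))) (S (h, s)) :=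
        ((hfd.differentiableOn one_ne_zero).differentiableAt (hRo.mem_nhds (hmem h))).hasFDerivAt
      have h2 := (h1.comp h (hasStrictFDerivAt_graphChart_left hg h s).hasFDerivAt).fderiv
      exact congrArg (fun L => L w) h2
    simp only [← hd2]
    exact integral_fderiv_apply_eq_zero _ hd1
      (hfs.comp_isClosedEmbedding (isClosedEmbedding_graphChart_left he hgc s)) w
  have hnor : ∫ p in U, fderiv ℝ f (S p) (c p.1 • e) = - ∫ h, f (graphMap e g h) * c h := by
    rw [IntegrableOn, hrestr] at hI2
    have hI3 := hint (fun _ => e) continuous_const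
    rw [IntegrableOn, hrestr] at hI3
    rw [hrestr, integral_prod _ hI2, ← integral_neg]
    refine integral_congr_ae ?_
    filter_upwards [hI3.prod_right_ae] with h hh
    have hcs : HasCompactSupport fun s => f (S (h, s)) :=
      hfs.comp_isClosedEmbedding (isClosedEmbedding_graphChart_right he hgc h)
    have := integral_Ioi_of_hasDerivAt_of_tendsto (f := fun s => f (S (h, s))) (a := 0) (m := 0)
      (f' := fun s => fderiv ℝ f (S (h, s)) e)
      (by fun_prop) ?_ hh ?_
    · simp only [map_smul, smul_eq_mul]
      rw [integral_const_mul, this, hS, graphChart_zero]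
      ring
    · intro s hs
      have h1 : HasFDerivAt f (fderiv ℝ f (S (h, s))) (S (h, s)) :=
        ((hfd.differentiableOn one_ne_zero).differentiableAt
          (hRo.mem_nhds ((graphChart_mem_epigraph he (h, s)).2 hs))).hasFDerivAt
      exact h1.comp_hasDerivAt s (hasDerivAt_graphChart_right h s)
    · exact (hcs.is_zero_at_infty).mono_left atTop_le_cocompact
  have hemb : MeasurableEmbedding S := (graphHomeo he hgc).measurableEmbedding
  rw [← (measurePreserving_graphChart he hgc).setIntegral_preimage_emb hemb, ← hS, hUR]
  simp only [hdec]
  rw [integral_sub hI1 hI2, htan, hnor]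
  ring

end Epigraph

/-! ### The area formula for graphs -/

section Area

/-- Two measures whose ratio is locally within any factor `c > 1` are equal. -/
lemma measure_eq_of_locally_le_mul {X : Type*} [TopologicalSpace X] [SecondCountableTopology X]
    [MeasurableSpace X] [OpensMeasurableSpace X] {μ ν : Measure X}
    (h : ∀ c : NNReal, 1 < c → ∀ x, ∃ U ∈ 𝓝 x, ∀ A ⊆ U, MeasurableSet A →
      μ A ≤ c * ν A ∧ ν A ≤ c * μ A) : μ = ν := by
  have key : ∀ μ ν : Measure X, (∀ c : NNReal, 1 < c → ∀ x, ∃ U ∈ 𝓝 x, ∀ A ⊆ U,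
      MeasurableSet A → μ A ≤ c * ν A) → ∀ A, MeasurableSet A → μ A ≤ ν A := by
    intro μ ν h A hA
    have hc : ∀ c : NNReal, 1 < c → μ A ≤ c * ν A := by
      intro c hc
      rcases isEmpty_or_nonempty X with hX | hX
      · simp [eq_empty_of_isEmpty A]
      choose U hU hUA using h c hc
      obtain ⟨s, hs, hsu⟩ := TopologicalSpace.countable_cover_nhds
        (fun x => interior_mem_nhds.2 (hU x))
      have hsne : s.Nonempty := by
        rw [nonempty_iff_ne_empty]
        rintro rfl
        simp at hsu
        exact not_isEmpty_of_nonempty X (univ_eq_empty_iff.1 hsu.symm)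
      obtain ⟨k, rfl⟩ := hs.exists_eq_range hsne
      set B : ℕ → Set X := disjointed fun n => interior (U (k n)) with hB
      have hBm : ∀ n, MeasurableSet (B n) :=
        MeasurableSet.disjointed fun n => isOpen_interior.measurableSet
      have hBu : ⋃ n, B n = univ := by
        rw [hB, iUnion_disjointed]
        simpa using hsu
      have hBd : Pairwise (Function.onFun Disjoint fun n => A ∩ B n) := fun i j hij =>
        (disjoint_disjointed _ hij).mono inter_subset_right inter_subset_right
      have hAe : ∀ ρ : Measure X, ρ A = ∑' n, ρ (A ∩ B n) := by
        intro ρ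
        rw [← measure_iUnion hBd fun n => hA.inter (hBm n), ← inter_iUnion, hBu, inter_univ]
      rw [hAe μ, hAe ν, ← ENNReal.tsum_mul_left]
      refine ENNReal.tsum_le_tsum fun n => hUA (k n) _ ?_ (hA.inter (hBm n))
      exact inter_subset_right.trans ((disjointed_subset _ n).trans interior_subset)
    rcases eq_or_ne (ν A) ⊤ with hν | hν
    · simp [hν]
    refine le_of_forall_gt_imp_ge_of_dense fun b hb => ?_
    have ht : Tendsto (fun c : NNReal => (c : ENNReal) * ν A) (𝓝[>] 1) (𝓝 (ν A)) := by
      have : Continuous fun c : NNReal => (c : ENNReal) * ν A :=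
        (ENNReal.continuous_mul_const hν).comp ENNReal.continuous_coe
      simpa using (this.tendsto 1).mono_left nhdsWithin_le_nhds
    have : (𝓝[>] (1 : NNReal)).NeBot := inferInstance
    obtain ⟨c, hc1, hc2⟩ := ((ht.eventually (gt_mem_nhds hb)).and self_mem_nhdsWithin).exists
    exact (hc c hc2).trans hc1.le
  ext A hA
  refine le_antisymm (key μ ν (fun c hc x => ?_) A hA) (key ν μ (fun c hc x => ?_) A hA)
  · obtain ⟨U, hU, h'⟩ := h c hc x
    exact ⟨U, hU, fun A hA hm => (h' A hA hm).1⟩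
  · obtain ⟨U, hU, h'⟩ := h c hc x
    exact ⟨U, hU, fun A hA hm => (h' A hA hm).2⟩

/-- If `p` expands distances on `A` at most `K` times as much as `q`, then the Hausdorff measure of
`p '' A` is at most `K ^ m` times that of `q '' A`. -/
lemma euclideanHausdorffMeasure_image_le_of_dist_le {X Y Z : Type*} [MetricSpace Y]
    [MetricSpace Z] [MeasurableSpace Y] [BorelSpace Y] [MeasurableSpace Z] [BorelSpace Z]
    (m : ℕ) {p : X → Y} {q : X → Z} {A : Set X} {K : NNReal}
    (h : ∀ x ∈ A, ∀ y ∈ A, dist (p x) (p y) ≤ K * dist (q x) (q y)) :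
    Measure.euclideanHausdorffMeasure m (p '' A) ≤
      (K : ENNReal) ^ m * Measure.euclideanHausdorffMeasure m (q '' A) := by
  rcases A.eq_empty_or_nonempty with rfl | ⟨x0, hx0⟩
  · simp
  have : Nonempty X := ⟨x0⟩
  -- `p` factors through `q` on `A`
  let r := Function.invFunOn q A
  have hr : ∀ x ∈ A, p (r (q x)) = p x := by
    intro x hx
    have hm : r (q x) ∈ A := Function.invFunOn_mem ⟨x, hx, rfl⟩
    have he : q (r (q x)) = q x := Function.invFunOn_eq ⟨x, hx, rfl⟩
    have := h _ hm _ hx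
    rw [he, dist_self, mul_zero] at this
    exact dist_le_zero.1 this
  have hL : LipschitzOnWith K (p ∘ r) (q '' A) := by
    refine LipschitzOnWith.of_dist_le_mul ?_
    rintro _ ⟨x, hx, rfl⟩ _ ⟨y, hy, rfl⟩
    simp only [Function.comp_apply, hr x hx, hr y hy]
    exact h x hx y hy
  have himg : (p ∘ r) '' (q '' A) = p '' A := by
    rw [image_image]
    exact image_congr hr
  have := hL.hausdorffMeasure_image_le (d := m) (by positivity)
  rw [himg, ENNReal.rpow_natCast] at this
  simp only [Measure.euclideanHausdorffMeasure_def, Measure.smul_apply, ENNReal.smul_def,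
    smul_eq_mul]
  calc _ ≤ _ := mul_le_mul_right this _
    _ = _ := by ring

variable {d : ℕ} {e : EuclideanSpace ℝ (Fin d)} {g : EuclideanSpace ℝ (Fin d) → ℝ}

/-- The normal vector `∇g(h) - e` of the graph of `g` at the point over `h`, pointing below the
graph; the gradient is taken along the hyperplane, and the vector is not normalized. -/
noncomputable def graphNormal {d : ℕ} (e : EuclideanSpace ℝ (Fin d))
    (g : EuclideanSpace ℝ (Fin d) → ℝ) (h : (ℝ ∙ e)ᗮ) : EuclideanSpace ℝ (Fin d) :=
  ((InnerProductSpace.toDual ℝ (ℝ ∙ e)ᗮ).symm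
    ((fderiv ℝ g h).comp (ℝ ∙ e)ᗮ.subtypeL) : EuclideanSpace ℝ (Fin d)) - e

lemma inner_toDual_symm_fderiv (h w : (ℝ ∙ e)ᗮ) :
    inner ℝ ((InnerProductSpace.toDual ℝ (ℝ ∙ e)ᗮ).symm
    ((fderiv ℝ g h).comp (ℝ ∙ e)ᗮ.subtypeL)) w = fderiv ℝ g h w := by
  simp

lemma inner_graphNormal (he : ‖e‖ = 1) (h : (ℝ ∙ e)ᗮ) (v : EuclideanSpace ℝ (Fin d)) :
    inner ℝ v (graphNormal e g h) = fderiv ℝ g h (hyperplaneProj he v) - inner ℝ e v := by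
  rw [← inner_toDual_symm_fderiv, graphNormal]
  set a := (InnerProductSpace.toDual ℝ (ℝ ∙ e)ᗮ).symm
    ((fderiv ℝ g h).comp (ℝ ∙ e)ᗮ.subtypeL)
  rw [inner_sub_right, real_inner_comm, real_inner_comm v e, Submodule.coe_inner,
    coe_hyperplaneProj, inner_sub_right, inner_smul_right, real_inner_comm e (a : _),
    inner_orthogonal_span]
  ring

lemma norm_sq_graphNormal (he : ‖e‖ = 1) (h : (ℝ ∙ e)ᗮ) :
    ‖graphNormal e g h‖ ^ 2 = 1 + fderiv ℝ g h ((InnerProductSpace.toDual ℝ (ℝ ∙ e)ᗮ).symm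
      ((fderiv ℝ g h).comp (ℝ ∙ e)ᗮ.subtypeL)) := by
  rw [← inner_toDual_symm_fderiv, graphNormal, @norm_sub_sq ℝ, he]
  rw [real_inner_comm, inner_orthogonal_span, ← real_inner_self_eq_norm_sq, Submodule.coe_inner]
  simp
  ring

lemma one_le_norm_graphNormal (he : ‖e‖ = 1) (h : (ℝ ∙ e)ᗮ) : 1 ≤ ‖graphNormal e g h‖ := by
  have h1 := norm_sq_graphNormal (g := g) he h
  rw [← inner_toDual_symm_fderiv] at h1
  have h2 := real_inner_self_nonneg (x := ((InnerProductSpace.toDual ℝ (ℝ ∙ e)ᗮ).symm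
      ((fderiv ℝ g h).comp (ℝ ∙ e)ᗮ.subtypeL)))
  nlinarith [norm_nonneg (graphNormal e g h)]

lemma continuous_graphNormal (hg : ContDiff ℝ 1 g) : Continuous (graphNormal e g) := by
  have h1 : Continuous fun h : (ℝ ∙ e)ᗮ => fderiv ℝ g (h : EuclideanSpace ℝ (Fin d)) :=
    (hg.continuous_fderiv one_ne_zero).comp (by fun_prop)
  have h2 : Continuous fun h : (ℝ ∙ e)ᗮ => (fderiv ℝ g h).comp (ℝ ∙ e)ᗮ.subtypeL :=
    h1.clm_comp continuous_const
  have h3 := (InnerProductSpace.toDual ℝ (ℝ ∙ e)ᗮ).symm.continuous.comp h2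
  exact (continuous_subtype_val.comp h3).sub continuous_const

lemma inner_graphDeriv (he : ‖e‖ = 1) (h w u : (ℝ ∙ e)ᗮ) :
    inner ℝ (graphDeriv e g h w) (graphDeriv e g h u) =
      inner ℝ w u + fderiv ℝ g h w * fderiv ℝ g h u := by
  simp only [graphDeriv_apply, inner_add_left, inner_add_right, inner_smul_left, inner_smul_right,
    inner_orthogonal_span, real_inner_comm e, Submodule.coe_inner, real_inner_self_eq_norm_sq, he]
  simp [mul_comm]

/-- The Jacobian of the graph map is the length of the normal vector: its Gram operator is the
identity plus a rank-one operator. -/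
lemma normDet_graphDeriv (he : ‖e‖ = 1) (h : (ℝ ∙ e)ᗮ) :
    (graphDeriv e g h : (ℝ ∙ e)ᗮ →ₗ[ℝ] EuclideanSpace ℝ (Fin d)).normDet =
      ‖graphNormal e g h‖ := by
  rw [← sq_eq_sq₀ (LinearMap.normDet_nonneg _) (norm_nonneg _), norm_sq_graphNormal he]
  set a := (InnerProductSpace.toDual ℝ (ℝ ∙ e)ᗮ).symm
    ((fderiv ℝ g h).comp (ℝ ∙ e)ᗮ.subtypeL) with ha
  set D : Module.Dual ℝ (ℝ ∙ e)ᗮ := ((fderiv ℝ g h).comp (ℝ ∙ e)ᗮ.subtypeL).toLinearMap with hD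
  have h1 := LinearMap.normDet_sq (𝕜 := ℝ)
    (graphDeriv e g h : (ℝ ∙ e)ᗮ →ₗ[ℝ] EuclideanSpace ℝ (Fin d))
  have h2 : (graphDeriv e g h : (ℝ ∙ e)ᗮ →ₗ[ℝ] EuclideanSpace ℝ (Fin d)).adjoint ∘ₗ
      (graphDeriv e g h : (ℝ ∙ e)ᗮ →ₗ[ℝ] EuclideanSpace ℝ (Fin d)) =
        LinearMap.transvection D a := by
    ext1 w
    refine ext_inner_right ℝ fun u => ?_
    rw [LinearMap.comp_apply, LinearMap.adjoint_inner_left, LinearMap.transvection.apply,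
      inner_add_left, inner_smul_left, ha, inner_toDual_symm_fderiv]
    simpa [hD] using inner_graphDeriv he h w u
  rw [h2, LinearMap.transvection.det] at h1
  simpa [hD] using h1

lemma norm_le_norm_graphDeriv (he : ‖e‖ = 1) (h w : (ℝ ∙ e)ᗮ) :
    ‖w‖ ≤ ‖graphDeriv e g h w‖ := by
  have h1 := inner_graphDeriv (g := g) he h w w
  rw [real_inner_self_eq_norm_sq, real_inner_self_eq_norm_sq] at h1
  exact abs_le_of_sq_le_sq' (by nlinarith [mul_self_nonneg (fderiv ℝ g h w)]) (norm_nonneg _) |>.2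

lemma norm_sub_le_norm_graphMap_sub (he : ‖e‖ = 1) (h h' : (ℝ ∙ e)ᗮ) :
    ‖h - h'‖ ≤ ‖graphMap e g h - graphMap e g h'‖ := by
  have h1 : graphMap e g h - graphMap e g h' =
      ((h - h' : (ℝ ∙ e)ᗮ) : EuclideanSpace ℝ (Fin d)) + (g h - g h') • e := by
    simp only [graphMap, Submodule.coe_sub]; module
  have h2 : ‖graphMap e g h - graphMap e g h'‖ ^ 2 = ‖h - h'‖ ^ 2 + (g h - g h') ^ 2 := by
    rw [h1, @norm_add_sq ℝ, inner_smul_right, real_inner_comm, inner_orthogonal_span, norm_smul,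
      he, mul_one, Real.norm_eq_abs, sq_abs]
    simp
  exact abs_le_of_sq_le_sq' (by nlinarith) (norm_nonneg _) |>.2

/-- The area formula for a graph: its surface measure is the image of `√(1 + |∇g|²) dh`. Locally
the graph map and its derivative distort distances by a factor close to one, so Hausdorff measures
may be compared with the linear case. -/
theorem comap_graphMap_euclideanHausdorffMeasure (he : ‖e‖ = 1) (hg : ContDiff ℝ 1 g) :
    (Measure.euclideanHausdorffMeasure (d - 1)).comap (graphMap e g) =
      (volume : Measure (ℝ ∙ e)ᗮ).withDensity fun h => ENNReal.ofReal ‖graphNormal e g h‖ := by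
  have hemb := (isClosedEmbedding_graphMap he hg.continuous).measurableEmbedding
  have hNc := continuous_graphNormal (e := e) hg
  refine measure_eq_of_locally_le_mul fun c hc h0 => ?_
  -- a factor `K > 1` with `K ^ d ≤ c`
  obtain ⟨K, hK1, hKc⟩ : ∃ K : NNReal, 1 < K ∧ K ^ (d - 1 + 1) ≤ c := by
    have ht : Tendsto (fun K : NNReal => K ^ (d - 1 + 1)) (𝓝[>] 1) (𝓝 1) := by
      simpa using ((continuous_pow (M := NNReal) (d - 1 + 1)).tendsto 1).mono_left
        nhdsWithin_le_nhds
    have : (𝓝[>] (1 : NNReal)).NeBot := inferInstance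
    obtain ⟨K, h1, h2⟩ := ((ht.eventually (gt_mem_nhds hc)).and self_mem_nhdsWithin).exists
    exact ⟨K, h2, h1.le⟩
  set J : (ℝ ∙ e)ᗮ → ℝ := fun h => ‖graphNormal e g h‖ with hJ
  have hJc : Continuous J := hNc.norm
  have hJ0 : 0 < J h0 := lt_of_lt_of_le one_pos (one_le_norm_graphNormal he h0)
  have hK1' : (1 : ℝ) < K := hK1
  have hU1 : ∀ᶠ h in 𝓝 h0, J h ≤ K * J h0 :=
    (hJc.tendsto h0).eventually (ge_mem_nhds (by nlinarith))
  have hU2 : ∀ᶠ h in 𝓝 h0, J h0 ≤ K * J h :=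
    ((hJc.const_smul (K : ℝ)).tendsto h0).eventually (le_mem_nhds
      (show J h0 < (K : ℝ) • J h0 by rw [smul_eq_mul]; nlinarith))
  set L := graphDeriv e g h0 with hL
  have hst : HasStrictFDerivAt (graphMap e g) L h0 := by
    simpa [graphChart_zero] using hasStrictFDerivAt_graphChart_left hg h0 0
  obtain ⟨U3, hU3, happ⟩ : ∃ U ∈ 𝓝 h0, ∀ x ∈ U, ∀ y ∈ U,
      ‖graphMap e g x - graphMap e g y - L (x - y)‖ ≤ (K - 1 : ℝ) * ‖x - y‖ := by
    have := hst.isLittleO.def (sub_pos.2 hK1')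
    rw [nhds_prod_eq, Filter.eventually_prod_self_iff'] at this
    obtain ⟨U, hU, h⟩ := this
    exact ⟨U, hU, fun x hx y hy => h x hx y hy⟩
  refine ⟨_, inter_mem (inter_mem hU1 hU2) hU3, fun A hA hAm => ?_⟩
  have hm := finrank_hyperplane he
  have hlin : Measure.euclideanHausdorffMeasure (d - 1) (L '' A) =
      ENNReal.ofReal (J h0) * volume A := by
    have := LinearMap.euclideanHausdorffMeasure_image_eq_normDet_mul_volume
      (L : (ℝ ∙ e)ᗮ →ₗ[ℝ] EuclideanSpace ℝ (Fin d)) A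
    rw [hm, normDet_graphDeriv he] at this
    exact this
  have hd1 : Measure.euclideanHausdorffMeasure (d - 1) (graphMap e g '' A) ≤
      (K : ENNReal) ^ (d - 1) * Measure.euclideanHausdorffMeasure (d - 1) (L '' A) := by
    refine euclideanHausdorffMeasure_image_le_of_dist_le _ fun x hx y hy => ?_
    rw [dist_eq_norm, dist_eq_norm, ← map_sub]
    have h1 := happ x (hA hx).2 y (hA hy).2
    have h2 := norm_le_norm_graphDeriv (g := g) he h0 (x - y)
    have h3 := norm_sub_norm_le (graphMap e g x - graphMap e g y) (L (x - y))
    nlinarith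
  have hd2 : Measure.euclideanHausdorffMeasure (d - 1) (L '' A) ≤
      (K : ENNReal) ^ (d - 1) * Measure.euclideanHausdorffMeasure (d - 1) (graphMap e g '' A) := by
    refine euclideanHausdorffMeasure_image_le_of_dist_le _ fun x hx y hy => ?_
    rw [dist_eq_norm, dist_eq_norm, ← map_sub]
    have h1 := happ x (hA hx).2 y (hA hy).2
    have h2 := norm_sub_le_norm_graphMap_sub (g := g) he x y
    have h3 := norm_sub_norm_le (L (x - y)) (graphMap e g x - graphMap e g y)
    rw [norm_sub_rev (L (x - y))] at h3
    nlinarith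
  have hv1 : ∫⁻ h in A, ENNReal.ofReal (J h) ≤ K * (ENNReal.ofReal (J h0) * volume A) := by
    calc _ ≤ ∫⁻ h in A, K * ENNReal.ofReal (J h0) := by
          refine setLIntegral_mono' hAm fun h hh => ?_
          rw [← ENNReal.ofReal_coe_nnreal, ← ENNReal.ofReal_mul (by positivity)]
          exact ENNReal.ofReal_le_ofReal (hA hh).1.1
      _ = _ := by simp [mul_assoc]
  have hv2 : ENNReal.ofReal (J h0) * volume A ≤ K * ∫⁻ h in A, ENNReal.ofReal (J h) := by
    calc _ = ∫⁻ h in A, ENNReal.ofReal (J h0) := by simp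
      _ ≤ ∫⁻ h in A, K * ENNReal.ofReal (J h) := by
          refine setLIntegral_mono' hAm fun h hh => ?_
          rw [← ENNReal.ofReal_coe_nnreal, ← ENNReal.ofReal_mul (by positivity)]
          exact ENNReal.ofReal_le_ofReal (hA hh).1.2
      _ = _ := lintegral_const_mul _ (by fun_prop)
  have hcK : (K : ENNReal) ^ (d - 1) * K ≤ c := by
    rw [← pow_succ]; exact_mod_cast hKc
  rw [hemb.comap_apply, withDensity_apply _ hAm]
  constructor
  · calc _ ≤ _ := hd1
      _ ≤ (K : ENNReal) ^ (d - 1) * (K * ∫⁻ h in A, ENNReal.ofReal (J h)) := by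
          rw [hlin]; gcongr
      _ ≤ _ := by rw [← mul_assoc]; gcongr
  · calc _ ≤ _ := hv1
      _ ≤ K * ((K : ENNReal) ^ (d - 1) *
          Measure.euclideanHausdorffMeasure (d - 1) (graphMap e g '' A)) := by
          rw [← hlin]; gcongr
      _ ≤ _ := by rw [← mul_assoc, mul_comm (K : ENNReal)]; gcongr

end Area

/-! ### Boundary patches and the outward normal -/

section Boundary

variable {d : ℕ} {e : EuclideanSpace ℝ (Fin d)} {g : EuclideanSpace ℝ (Fin d) → ℝ}

/-- The height of `x` over the graph of `g` in the direction `e`. -/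
noncomputable def graphHeight {d : ℕ} (e : EuclideanSpace ℝ (Fin d))
    (g : EuclideanSpace ℝ (Fin d) → ℝ) (x : EuclideanSpace ℝ (Fin d)) : ℝ :=
  inner ℝ e x - g (x - inner ℝ e x • e)

lemma continuous_graphHeight (hg : Continuous g) : Continuous (graphHeight e g) := by
  unfold graphHeight; fun_prop

lemma mem_epigraph_iff {x : EuclideanSpace ℝ (Fin d)} :
    x ∈ epigraph e g ↔ 0 < graphHeight e g x := by
  simp [epigraph, graphHeight]

lemma graphHeight_graphChart (he : ‖e‖ = 1) (p : (ℝ ∙ e)ᗮ × ℝ) :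
    graphHeight e g (graphChart e g p) = p.2 := by
  rw [graphHeight, ← coe_hyperplaneProj he, hyperplaneProj_graphChart, inner_graphChart he]
  ring

lemma graphHeight_graphMap (he : ‖e‖ = 1) (h : (ℝ ∙ e)ᗮ) :
    graphHeight e g (graphMap e g h) = 0 := by
  rw [← graphChart_zero, graphHeight_graphChart he]

lemma frontier_epigraph (he : ‖e‖ = 1) (hg : Continuous g) :
    frontier (epigraph e g) = range (graphMap e g) := by
  have h1 : graphHomeo he hg ⁻¹' epigraph e g = univ ×ˢ Ioi 0 := by
    ext p
    exact (graphChart_mem_epigraph he p).trans (by simp)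
  have h2 : graphHomeo he hg ⁻¹' range (graphMap e g) = univ ×ˢ {0} := by
    ext p
    simp only [mem_preimage, mem_range, mem_prod, mem_univ, true_and, mem_singleton_iff]
    constructor
    · rintro ⟨h, hh⟩
      rw [← graphHeight_graphChart (g := g) he p]
      change graphHeight e g (graphHomeo he hg p) = 0
      rw [← hh, graphHeight_graphMap he]
    · intro hp
      refine ⟨p.1, ?_⟩
      rw [← graphChart_zero, ← hp]
      rfl
  apply (graphHomeo he hg).surjective.preimage_injective
  rw [Homeomorph.preimage_frontier, h1, h2, frontier_univ_prod_eq, frontier_Ioi]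

lemma hasFDerivAt_graphHeight (he : ‖e‖ = 1) (hg : ContDiff ℝ 1 g) (h : (ℝ ∙ e)ᗮ) :
    HasFDerivAt (graphHeight e g) (-innerSL ℝ (graphNormal e g h)) (graphMap e g h) := by
  have hp : (hyperplaneProj he (graphMap e g h) : EuclideanSpace ℝ (Fin d)) = h := by
    rw [← graphChart_zero, hyperplaneProj_graphChart]
  have h1 : HasFDerivAt g (fderiv ℝ g h)
      ((ℝ ∙ e)ᗮ.subtypeL.comp (hyperplaneProj he) (graphMap e g h)) := by
    rw [ContinuousLinearMap.comp_apply, Submodule.subtypeL_apply, hp]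
    exact (hg.differentiable one_ne_zero _).hasFDerivAt
  have h2 := (innerSL ℝ e).hasFDerivAt (x := graphMap e g h) |>.sub
    (h1.comp (graphMap e g h) ((ℝ ∙ e)ᗮ.subtypeL.comp (hyperplaneProj he)).hasFDerivAt)
  have h3 : graphHeight e g = ⇑(innerSL ℝ e) - g ∘ ((ℝ ∙ e)ᗮ.subtypeL.comp (hyperplaneProj he)) := by
    ext x
    simp [graphHeight]
  rw [h3]
  refine h2.congr_fderiv ?_
  ext v
  simp only [neg_apply, innerSL_apply_apply]
  rw [real_inner_comm, inner_graphNormal he]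
  simp

/-- The tangent space of a graph is the hyperplane orthogonal to `graphNormal`. -/
lemma tangentConeAt_range_graphMap (he : ‖e‖ = 1) (hg : ContDiff ℝ 1 g) (h : (ℝ ∙ e)ᗮ) :
    tangentConeAt ℝ (range (graphMap e g)) (graphMap e g h) =
      {v | inner ℝ v (graphNormal e g h) = 0} := by
  apply Subset.antisymm
  · intro v hv
    have h1 := (hasFDerivAt_graphHeight he hg h).hasFDerivWithinAt (s := range (graphMap e g))
    have h2 : HasFDerivWithinAt (graphHeight e g) (0 : EuclideanSpace ℝ (Fin d) →L[ℝ] ℝ)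
        (range (graphMap e g)) (graphMap e g h) := by
      refine (hasFDerivWithinAt_const (0 : ℝ) _ _).congr ?_ (graphHeight_graphMap he h)
      rintro _ ⟨k, rfl⟩
      exact graphHeight_graphMap he k
    have h3 := h1.unique_on h2 hv
    simp only [neg_apply, innerSL_apply_apply, zero_apply,
      neg_eq_zero] at h3
    rw [mem_ofPred_eq, real_inner_comm, h3]
  · intro v hv
    rw [mem_ofPred_eq, inner_graphNormal he] at hv
    have h1 : HasFDerivAt (graphMap e g) (graphDeriv e g h) h := by
      simpa [graphChart_zero] using (hasStrictFDerivAt_graphChart_left hg h 0).hasFDerivAt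
    have h2 := (h1.hasFDerivWithinAt (s := univ)).mapsTo_tangent_cone
      (show hyperplaneProj he v ∈ tangentConeAt ℝ univ h by rw [tangentConeAt_univ]; trivial)
    rw [image_univ, graphDeriv_apply, sub_eq_zero.1 hv, coe_hyperplaneProj] at h2
    simpa using h2

/-- Derivatives within the region above a graph are determined at its boundary points, since the
straightening coordinates map a half-space onto the region with invertible derivative. -/
lemma uniqueDiffWithinAt_epigraph (he : ‖e‖ = 1) (hg : ContDiff ℝ 1 g) (h : (ℝ ∙ e)ᗮ) :
    UniqueDiffWithinAt ℝ (epigraph e g) (graphMap e g h) := by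
  have h1 : HasFDerivAt (graphChart e g)
      ((graphDeriv e g h).comp (ContinuousLinearMap.fst ℝ _ ℝ) +
        (ContinuousLinearMap.snd ℝ (ℝ ∙ e)ᗮ ℝ).smulRight e) (h, 0) := by
    have h3 : HasFDerivAt (fun h => graphChart e g (h, 0)) (graphDeriv e g h) h :=
      (hasStrictFDerivAt_graphChart_left hg h 0).hasFDerivAt
    have h4 : HasFDerivAt (fun p : (ℝ ∙ e)ᗮ × ℝ => p.2 • e)
        ((ContinuousLinearMap.snd ℝ (ℝ ∙ e)ᗮ ℝ).smulRight e) (h, 0) :=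
      ((ContinuousLinearMap.snd ℝ (ℝ ∙ e)ᗮ ℝ).smulRight e).hasFDerivAt
    have h5 : HasFDerivAt (Prod.fst : (ℝ ∙ e)ᗮ × ℝ → _) (ContinuousLinearMap.fst ℝ _ ℝ) (h, 0) :=
      hasFDerivAt_fst
    have h6 := (HasFDerivAt.comp (f := (Prod.fst : (ℝ ∙ e)ᗮ × ℝ → _)) (h, (0 : ℝ)) h3 h5).add h4
    have h7 : graphChart e g = ((fun h => graphChart e g (h, 0)) ∘ Prod.fst) +
        fun p : (ℝ ∙ e)ᗮ × ℝ => p.2 • e := by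
      ext1 p
      simp only [graphChart, Pi.add_apply, Function.comp_apply]
      module
    rw [h7]
    exact h6
  have h2 : UniqueDiffWithinAt ℝ ((univ : Set (ℝ ∙ e)ᗮ) ×ˢ Ioi (0 : ℝ)) (h, 0) := by
    refine uniqueDiffWithinAt_convex (convex_univ.prod (convex_Ioi 0)) ?_ ?_
    · rw [(isOpen_univ.prod isOpen_Ioi).interior_eq]
      exact ⟨(0, 1), by simp⟩
    · rw [closure_prod_eq, closure_Ioi]; simp
  have h3 := (h1.hasFDerivWithinAt).uniqueDiffWithinAt h2 (Function.Surjective.denseRange (by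
    intro v
    refine ⟨(hyperplaneProj he v, inner ℝ e v - fderiv ℝ g h (hyperplaneProj he v)), ?_⟩
    simp only [add_apply, ContinuousLinearMap.comp_apply,
      ContinuousLinearMap.coe_fst', ContinuousLinearMap.smulRight_apply,
      ContinuousLinearMap.coe_snd', graphDeriv_apply, coe_hyperplaneProj]
    module))
  rw [graphChart_zero] at h3
  refine h3.mono ?_
  rintro _ ⟨p, hp, rfl⟩
  exact (graphChart_mem_epigraph he p).2 hp.2

/-- In the ball `B(x₀, r)` the set `Ω` is the part above the graph of the `C^1` function `g` in
the direction of the unit vector `e`. -/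
structure IsGraphPatch {d : ℕ} (Ω : Set (EuclideanSpace ℝ (Fin d)))
    (x₀ : EuclideanSpace ℝ (Fin d)) (r : ℝ) (e : EuclideanSpace ℝ (Fin d))
    (g : EuclideanSpace ℝ (Fin d) → ℝ) : Prop where
  norm_eq : ‖e‖ = 1
  contDiff : ContDiff ℝ 1 g
  mem_iff : ∀ x ∈ Metric.ball x₀ r, x ∈ Ω ↔ x ∈ epigraph e g

variable {Ω : Set (EuclideanSpace ℝ (Fin d))} {x₀ : EuclideanSpace ℝ (Fin d)} {r : ℝ}

lemma IsGraphPatch.inter_eq (hP : IsGraphPatch Ω x₀ r e g) :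
    Ω ∩ Metric.ball x₀ r = epigraph e g ∩ Metric.ball x₀ r := by
  ext x
  exact and_congr_left fun hx => hP.mem_iff x hx

lemma IsGraphPatch.frontier_inter_eq (hP : IsGraphPatch Ω x₀ r e g) :
    frontier Ω ∩ Metric.ball x₀ r = range (graphMap e g) ∩ Metric.ball x₀ r := by
  rw [← frontier_epigraph hP.norm_eq hP.contDiff.continuous,
    ← frontier_inter_open_inter Metric.isOpen_ball, hP.inter_eq,
    frontier_inter_open_inter Metric.isOpen_ball]

lemma IsGraphPatch.uniqueDiffWithinAt (hP : IsGraphPatch Ω x₀ r e g) {h : (ℝ ∙ e)ᗮ}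
    (hh : graphMap e g h ∈ Metric.ball x₀ r) :
    UniqueDiffWithinAt ℝ (closure Ω) (graphMap e g h) := by
  have h1 := (uniqueDiffWithinAt_epigraph hP.norm_eq hP.contDiff h).inter
    (Metric.isOpen_ball.mem_nhds hh)
  rw [← hP.inter_eq] at h1
  exact h1.mono (inter_subset_left.trans subset_closure)

/-- Orthogonality to the tangent space of the graph determines a unit normal up to sign, and the
sign is fixed because leaving the point along `graphNormal` decreases the height over the graph. -/
lemma IsGraphPatch.isOutwardUnitNormal_iff (hP : IsGraphPatch Ω x₀ r e g) {h : (ℝ ∙ e)ᗮ}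
    (hh : graphMap e g h ∈ Metric.ball x₀ r) (ν : EuclideanSpace ℝ (Fin d)) :
    IsOutwardUnitNormal Ω (graphMap e g h) ν ↔
      ν = ‖graphNormal e g h‖⁻¹ • graphNormal e g h := by
  set N := graphNormal e g h with hN
  set x := graphMap e g h with hx
  have hNn : 0 < ‖N‖ := lt_of_lt_of_le one_pos (one_le_norm_graphNormal hP.norm_eq h)
  have hball := Metric.isOpen_ball.mem_nhds hh
  have hcone : tangentConeAt ℝ (frontier Ω) x = {v | inner ℝ v N = 0} := by
    rw [← tangentConeAt_inter_nhds hball, hP.frontier_inter_eq, tangentConeAt_inter_nhds hball,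
      hx, tangentConeAt_range_graphMap hP.norm_eq hP.contDiff]
  -- along `x + s v` the height over the graph has derivative `-⟪v, N⟫` at `s = 0`
  have hder : ∀ v, HasDerivAt (fun s : ℝ => graphHeight e g (x + s • v)) (-inner ℝ v N) 0 := by
    intro v
    have h1 : HasDerivAt (fun s : ℝ => x + s • v) v 0 := by
      simpa using ((hasDerivAt_id (0 : ℝ)).smul_const v).const_add x
    have h2 := hasFDerivAt_graphHeight hP.norm_eq hP.contDiff h
    rw [← hx, ← hN] at h2
    have h3 := HasFDerivAt.comp_hasDerivAt (x := (0 : ℝ)) (f := fun s : ℝ => x + s • v)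
      (by simpa using h2) h1
    simpa [real_inner_comm, Function.comp_def] using h3
  have h0 : graphHeight e g (x + (0 : ℝ) • N) = 0 := by
    simp [hx, graphHeight_graphMap hP.norm_eq]
  have hin : ∀ v, ∀ᶠ s : ℝ in 𝓝[>] 0, x + s • v ∈ Metric.ball x₀ r := by
    intro v
    have hc : Continuous fun s : ℝ => x + s • v := by fun_prop
    exact nhdsWithin_le_nhds (hc.tendsto 0 (by simpa using hball))
  have hneg : ∀ v, 0 < inner ℝ v N → ∀ᶠ s : ℝ in 𝓝[>] 0, x + s • v ∉ closure Ω := by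
    intro v hv
    have h2 := (hasDerivWithinAt_iff_tendsto_slope' (by simp)).1
      ((hder v).hasDerivWithinAt (s := Ioi 0))
    have h3 : ∀ᶠ s : ℝ in 𝓝[>] 0, slope (fun s : ℝ => graphHeight e g (x + s • v)) 0 s < 0 := by
      simpa using h2.eventually (gt_mem_nhds (neg_lt_zero.2 hv))
    filter_upwards [h3, hin v, self_mem_nhdsWithin] with s hs hsb hs0 hcl
    have h4 : graphHeight e g (x + s • v) < 0 := by
      have := hs
      rw [slope_def_field] at this
      simp only [zero_smul, add_zero, sub_zero, hx, graphHeight_graphMap hP.norm_eq] at this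
      exact neg_of_div_neg_left this (le_of_lt hs0)
    obtain ⟨y, ⟨hy1, hy2⟩, hy3⟩ := mem_closure_iff.1 hcl
      ({y | graphHeight e g y < 0} ∩ Metric.ball x₀ r)
      ((isOpen_lt (continuous_graphHeight hP.contDiff.continuous) continuous_const).inter
        Metric.isOpen_ball) ⟨h4, hsb⟩
    have := mem_epigraph_iff.1 ((hP.mem_iff y hy2).1 hy3)
    exact lt_asymm this hy1
  have hpos : ∀ v, inner ℝ v N < 0 → ∀ᶠ s : ℝ in 𝓝[>] 0, x + s • v ∈ Ω := by
    intro v hv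
    have h2 := (hasDerivWithinAt_iff_tendsto_slope' (by simp)).1
      ((hder v).hasDerivWithinAt (s := Ioi 0))
    have h3 : ∀ᶠ s : ℝ in 𝓝[>] 0, 0 < slope (fun s : ℝ => graphHeight e g (x + s • v)) 0 s := by
      simpa using h2.eventually (lt_mem_nhds (neg_pos.2 hv))
    filter_upwards [h3, hin v, self_mem_nhdsWithin] with s hs hsb hs0
    rw [hP.mem_iff _ hsb, mem_epigraph_iff]
    rw [slope_def_field] at hs
    simp only [zero_smul, add_zero, sub_zero, hx, graphHeight_graphMap hP.norm_eq] at hs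
    exact (div_pos_iff_of_pos_right hs0).1 hs
  constructor
  · rintro ⟨h1, h2, h3⟩
    rw [hcone] at h2
    -- `ν` is a multiple of `N`, since it is orthogonal to everything orthogonal to `N`
    have h4 : ν = (inner ℝ ν N / ‖N‖ ^ 2) • N := by
      have h5 := h2 (ν - (inner ℝ ν N / ‖N‖ ^ 2) • N) (by
        rw [mem_ofPred_eq, inner_sub_left, real_inner_smul_left, real_inner_self_eq_norm_sq]
        field_simp
        ring)
      have h6 : inner ℝ (ν - (inner ℝ ν N / ‖N‖ ^ 2) • N) N = 0 := by
        rw [inner_sub_left, real_inner_smul_left, real_inner_self_eq_norm_sq]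
        field_simp
        ring
      rw [← sub_eq_zero, ← inner_self_eq_zero (𝕜 := ℝ)]
      rw [inner_sub_right, h5, inner_smul_right, h6]
      simp
    set c := inner ℝ ν N / ‖N‖ ^ 2 with hc
    have hcn : |c| * ‖N‖ = 1 := by
      rw [← h1]
      conv_rhs => rw [h4]
      rw [norm_smul, Real.norm_eq_abs]
    have hc0 : 0 ≤ c := by
      by_contra hneg
      push Not at hneg
      have h5 := hpos ν (by
        rw [h4, real_inner_smul_left, real_inner_self_eq_norm_sq]
        exact mul_neg_of_neg_of_pos hneg (by positivity))
      obtain ⟨s, hs1, hs2⟩ := (h5.and h3).exists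
      exact hs2 (subset_closure hs1)
    rw [abs_of_nonneg hc0] at hcn
    rw [h4, eq_inv_of_mul_eq_one_left hcn]
  · rintro rfl
    refine ⟨by rw [norm_smul, norm_inv, norm_norm, inv_mul_cancel₀ hNn.ne'], ?_, ?_⟩
    · intro v hv
      rw [hcone] at hv
      rw [inner_smul_right, show inner ℝ v N = 0 from hv, mul_zero]
    · refine hneg _ ?_
      rw [real_inner_smul_left, real_inner_self_eq_norm_sq]
      positivity

lemma IsGraphPatch.outwardNormal_eq (hP : IsGraphPatch Ω x₀ r e g) {h : (ℝ ∙ e)ᗮ}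
    (hh : graphMap e g h ∈ Metric.ball x₀ r) :
    outwardNormal Ω (graphMap e g h) = ‖graphNormal e g h‖⁻¹ • graphNormal e g h := by
  have hex : ∃ ν, IsOutwardUnitNormal Ω (graphMap e g h) ν :=
    ⟨_, (hP.isOutwardUnitNormal_iff hh _).2 rfl⟩
  rw [outwardNormal, dif_pos hex]
  exact (hP.isOutwardUnitNormal_iff hh _).1 hex.choose_spec

lemma HasC1Boundary.exists_isGraphPatch (hΩ : HasC1Boundary Ω)
    (hx : x₀ ∈ frontier Ω) : ∃ r > 0, ∃ e g, IsGraphPatch Ω x₀ r e g := by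
  obtain ⟨r, hr, e, he, g, hg, h⟩ := hΩ x₀ hx
  exact ⟨r, hr, e, g, he, hg, h⟩

lemma HasC1Boundary.uniqueDiffOn_closure (hΩo : IsOpen Ω) (hΩ : HasC1Boundary Ω) :
    UniqueDiffOn ℝ (closure Ω) := by
  intro x hx
  by_cases hxΩ : x ∈ Ω
  · exact (hΩo.uniqueDiffWithinAt hxΩ).mono subset_closure
  have hxf : x ∈ frontier Ω := by rw [hΩo.frontier_eq]; exact ⟨hx, hxΩ⟩
  obtain ⟨r, hr, e, g, hP⟩ := hΩ.exists_isGraphPatch hxf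
  have hm : x ∈ range (graphMap e g) ∩ Metric.ball x r := by
    rw [← hP.frontier_inter_eq]; exact ⟨hxf, Metric.mem_ball_self hr⟩
  obtain ⟨⟨h, rfl⟩, hb⟩ := hm
  exact hP.uniqueDiffWithinAt hb

end Boundary

/-! ### The divergence theorem on a bounded C^1 domain -/

section Divergence

variable {d : ℕ} {Ω : Set (EuclideanSpace ℝ (Fin d))}

/-- The divergence theorem for the field `f v` when `f` is supported in a boundary patch. -/
lemma IsGraphPatch.setIntegral_fderiv_eq {x₀ : EuclideanSpace ℝ (Fin d)} {r : ℝ}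
    {e : EuclideanSpace ℝ (Fin d)} {g : EuclideanSpace ℝ (Fin d) → ℝ}
    (hP : IsGraphPatch Ω x₀ r e g) (hΩo : IsOpen Ω)
    {f : EuclideanSpace ℝ (Fin d) → ℝ} (hf : Continuous f)
    (hfs : tsupport f ⊆ Metric.ball x₀ r) (hfd : ContDiffOn ℝ 1 f Ω) {C : ℝ}
    (hC : ∀ x ∈ Ω, ‖fderiv ℝ f x‖ ≤ C) (v : EuclideanSpace ℝ (Fin d)) :
    Integrable (fun x => f x * inner ℝ v (outwardNormal Ω x)) (surfaceMeasure Ω) ∧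
      ∫ x in Ω, fderiv ℝ f x v =
        ∫ x, f x * inner ℝ v (outwardNormal Ω x) ∂(surfaceMeasure Ω) := by
  have hgc := hP.contDiff.continuous
  have hRo := isOpen_epigraph (e := e) hgc
  have hBo : IsOpen (Metric.ball x₀ r) := Metric.isOpen_ball
  have hcs : HasCompactSupport f :=
    Metric.isCompact_of_isClosed_isBounded (isClosed_tsupport f) (Metric.isBounded_ball.subset hfs)
  have hf0 : ∀ x, x ∉ Metric.ball x₀ r → f x = 0 := fun x hx =>
    image_eq_zero_of_notMem_tsupport fun h => hx (hfs h)
  have hD0 : ∀ x, x ∉ Metric.ball x₀ r → fderiv ℝ f x = 0 := fun x hx => by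
    by_contra h
    exact hx (hfs (support_fderiv_subset ℝ h))
  have hfdR : ContDiffOn ℝ 1 f (epigraph e g) := by
    intro x hx
    by_cases hb : x ∈ Metric.ball x₀ r
    · exact (hfd.contDiffAt (hΩo.mem_nhds ((hP.mem_iff x hb).2 hx))).contDiffWithinAt
    · have : f =ᶠ[𝓝 x] fun _ => 0 :=
        notMem_tsupport_iff_eventuallyEq.1 fun h => hb (hfs h)
      exact (contDiffAt_const.congr_of_eventuallyEq this).contDiffWithinAt
  have hCR : ∀ x ∈ epigraph e g, ‖fderiv ℝ f x‖ ≤ |C| := by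
    intro x hx
    by_cases hb : x ∈ Metric.ball x₀ r
    · exact (hC x ((hP.mem_iff x hb).2 hx)).trans (le_abs_self C)
    · rw [hD0 x hb, norm_zero]; exact abs_nonneg C
  have hvol : ∫ x in Ω, fderiv ℝ f x v = ∫ x in epigraph e g, fderiv ℝ f x v := by
    have hz : ∀ s : Set (EuclideanSpace ℝ (Fin d)), ∀ x ∈ s \ (s ∩ Metric.ball x₀ r),
        fderiv ℝ f x v = 0 := fun s x hx => by
      rw [hD0 x fun hb => hx.2 ⟨hx.1, hb⟩]; rfl
    rw [setIntegral_eq_of_subset_of_forall_sdiff_eq_zero hΩo.measurableSet inter_subset_left (hz Ω),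
      setIntegral_eq_of_subset_of_forall_sdiff_eq_zero hRo.measurableSet inter_subset_left (hz _),
      hP.inter_eq]
  set F : EuclideanSpace ℝ (Fin d) → ℝ := fun x => f x * inner ℝ v (outwardNormal Ω x) with hF
  have hF0 : ∀ x, x ∉ Metric.ball x₀ r → F x = 0 := fun x hx => by simp [hF, hf0 x hx]
  have hemb := (isClosedEmbedding_graphMap hP.norm_eq hgc).measurableEmbedding
  set μ : Measure (EuclideanSpace ℝ (Fin d)) := Measure.euclideanHausdorffMeasure (d - 1) with hμ
  have hrange : μ.restrict (range (graphMap e g)) =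
      ((volume : Measure (ℝ ∙ e)ᗮ).withDensity fun h => (‖graphNormal e g h‖₊ : ENNReal)).map
        (graphMap e g) := by
    rw [← hemb.map_comap, hμ, comap_graphMap_euclideanHausdorffMeasure hP.norm_eq hP.contDiff]
    simp only [ofReal_norm]
    rfl
  have hNm : Measurable fun h => ‖graphNormal e g h‖₊ :=
    (continuous_graphNormal hP.contDiff).nnnorm.measurable
  -- the length of the normal vector cancels against the density of the surface measure
  have hpull : ∀ h : (ℝ ∙ e)ᗮ, ‖graphNormal e g h‖₊ • F (graphMap e g h) =
      f (graphMap e g h) * inner ℝ v (graphNormal e g h) := by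
    intro h
    by_cases hb : graphMap e g h ∈ Metric.ball x₀ r
    · have hN : ‖graphNormal e g h‖ ≠ 0 :=
        (lt_of_lt_of_le one_pos (one_le_norm_graphNormal hP.norm_eq h)).ne'
      rw [NNReal.smul_def, coe_nnnorm, smul_eq_mul, hF]
      beta_reduce
      rw [hP.outwardNormal_eq hb, inner_smul_right]
      field_simp
    · rw [hF0 _ hb, hf0 _ hb]; simp
  have hintH : Integrable fun h : (ℝ ∙ e)ᗮ =>
      f (graphMap e g h) * inner ℝ v (graphNormal e g h) := by
    refine Continuous.integrable_of_hasCompactSupport ?_ ?_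
    · have h1 := (isClosedEmbedding_graphMap hP.norm_eq hgc).continuous
      have h2 := continuous_graphNormal (e := e) hP.contDiff
      fun_prop
    · exact (hcs.comp_isClosedEmbedding (isClosedEmbedding_graphMap hP.norm_eq hgc)).mul_right
  have hIr : IntegrableOn F (range (graphMap e g)) μ := by
    rw [IntegrableOn, hrange, hemb.integrable_map_iff,
      integrable_withDensity_iff_integrable_smul hNm]
    simpa only [Function.comp_apply, hpull] using hintH
  have hint : ∫ x in range (graphMap e g), F x ∂μ =
      ∫ h, f (graphMap e g h) * inner ℝ v (graphNormal e g h) := by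
    rw [hrange, hemb.integral_map, integral_withDensity_eq_integral_smul hNm]
    simp only [hpull]
  have hFrm : MeasurableSet (frontier Ω) := isClosed_frontier.measurableSet
  have hz : ∀ s : Set (EuclideanSpace ℝ (Fin d)), ∀ x ∈ s \ (s ∩ Metric.ball x₀ r), F x = 0 :=
    fun s x hx => hF0 x fun hb => hx.2 ⟨hx.1, hb⟩
  constructor
  · have : IntegrableOn F (frontier Ω ∩ Metric.ball x₀ r) μ := by
      rw [hP.frontier_inter_eq]
      exact hIr.mono_set inter_subset_left
    exact this.of_forall_sdiff_eq_zero hFrm (hz _)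
  · rw [hvol, setIntegral_fderiv_epigraph hP.norm_eq hP.contDiff hf hcs hfdR hCR v, surfaceMeasure]
    change _ = ∫ x in frontier Ω, F x ∂μ
    rw [setIntegral_eq_of_subset_of_forall_sdiff_eq_zero hFrm inter_subset_left (hz _),
      hP.frontier_inter_eq,
      ← setIntegral_eq_of_subset_of_forall_sdiff_eq_zero hemb.measurableSet_range
        inter_subset_left (hz _), hint]
    simp only [inner_graphNormal hP.norm_eq]

/-- The divergence theorem for the field `f v` when `f` is supported inside `Ω`. -/
lemma setIntegral_fderiv_eq_of_tsupport_subset (hΩo : IsOpen Ω) (hΩb : Bornology.IsBounded Ω)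
    {f : EuclideanSpace ℝ (Fin d) → ℝ} (hfs : tsupport f ⊆ Ω) (hfd : ContDiffOn ℝ 1 f Ω)
    (v : EuclideanSpace ℝ (Fin d)) :
    Integrable (fun x => f x * inner ℝ v (outwardNormal Ω x)) (surfaceMeasure Ω) ∧
      ∫ x in Ω, fderiv ℝ f x v =
        ∫ x, f x * inner ℝ v (outwardNormal Ω x) ∂(surfaceMeasure Ω) := by
  have hcs : HasCompactSupport f :=
    Metric.isCompact_of_isClosed_isBounded (isClosed_tsupport f) (hΩb.subset hfs)
  have hcd : ContDiff ℝ 1 f := by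
    rw [contDiff_iff_contDiffAt]
    intro x
    by_cases hx : x ∈ Ω
    · exact hfd.contDiffAt (hΩo.mem_nhds hx)
    · have : f =ᶠ[𝓝 x] fun _ => 0 :=
        notMem_tsupport_iff_eventuallyEq.1 fun h => hx (hfs h)
      exact contDiffAt_const.congr_of_eventuallyEq this
  have h0 : (fun x => f x * inner ℝ v (outwardNormal Ω x)) =ᵐ[surfaceMeasure Ω] fun _ => 0 := by
    refine (ae_restrict_iff' isClosed_frontier.measurableSet).2 (ae_of_all _ fun x hx => ?_)
    rw [hΩo.frontier_eq] at hx
    beta_reduce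
    rw [image_eq_zero_of_notMem_tsupport fun h => hx.2 (hfs h), zero_mul]
  refine ⟨(integrable_zero _ _ _).congr h0.symm, ?_⟩
  rw [integral_congr_ae h0, integral_zero, ← integral_fderiv_apply_eq_zero volume hcd hcs v]
  refine setIntegral_eq_integral_of_forall_compl_eq_zero fun x hx => ?_
  have : fderiv ℝ f x = 0 := by
    by_contra h
    exact hx (hfs (support_fderiv_subset ℝ h))
  rw [this]; rfl

/-- The divergence theorem on a bounded `C^1` domain for a field `f v` with `v` constant, where `f`
is continuous up to the boundary and has bounded continuous derivative inside. -/
theorem HasC1Boundary.setIntegral_fderiv_eq (hΩo : IsOpen Ω) (hΩb : Bornology.IsBounded Ω)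
    (hΩ : HasC1Boundary Ω) {f : EuclideanSpace ℝ (Fin d) → ℝ} (hfc : ContinuousOn f (closure Ω))
    (hfd : ContDiffOn ℝ 1 f Ω) {C : ℝ} (hC : ∀ x ∈ Ω, ‖fderiv ℝ f x‖ ≤ C)
    (v : EuclideanSpace ℝ (Fin d)) :
    Integrable (fun x => f x * inner ℝ v (outwardNormal Ω x)) (surfaceMeasure Ω) ∧
      ∫ x in Ω, fderiv ℝ f x v =
        ∫ x, f x * inner ℝ v (outwardNormal Ω x) ∂(surfaceMeasure Ω) := by
  -- a continuous extension of `f` to the whole space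
  obtain ⟨F, hF⟩ := ContinuousMap.exists_restrict_eq isClosed_closure
    (⟨(closure Ω).domRestrict f, continuousOn_iff_continuous_domRestrict.1 hfc⟩ : C(closure Ω, ℝ))
  have hFf : ∀ x ∈ closure Ω, F x = f x := fun x hx => congrArg (fun k => k ⟨x, hx⟩) hF
  have hKc : IsCompact (closure Ω) := hΩb.isCompact_closure
  -- an open set around each point of the closure in which the theorem is known
  have hloc : ∀ x : closure Ω, ∃ U : Set (EuclideanSpace ℝ (Fin d)), IsOpen U ∧ (x : EuclideanSpace ℝ (Fin d)) ∈ U ∧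
      ∀ u : EuclideanSpace ℝ (Fin d) → ℝ, Continuous u → tsupport u ⊆ U → ContDiffOn ℝ 1 u Ω →
        (∃ C : ℝ, ∀ x ∈ Ω, ‖fderiv ℝ u x‖ ≤ C) →
        Integrable (fun x => u x * inner ℝ v (outwardNormal Ω x)) (surfaceMeasure Ω) ∧
          ∫ x in Ω, fderiv ℝ u x v =
            ∫ x, u x * inner ℝ v (outwardNormal Ω x) ∂(surfaceMeasure Ω) := by
    rintro ⟨x, hx⟩
    by_cases hxΩ : x ∈ Ω
    · exact ⟨Ω, hΩo, hxΩ, fun u _ hus hud _ =>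
        setIntegral_fderiv_eq_of_tsupport_subset hΩo hΩb hus hud v⟩
    · have hxf : x ∈ frontier Ω := by rw [hΩo.frontier_eq]; exact ⟨hx, hxΩ⟩
      obtain ⟨r, hr, e, g, hP⟩ := hΩ.exists_isGraphPatch hxf
      exact ⟨Metric.ball x r, Metric.isOpen_ball, Metric.mem_ball_self hr,
        fun u hu hus hud ⟨C, hC⟩ => hP.setIntegral_fderiv_eq hΩo hu hus hud hC v⟩
  choose U hUo hxU hU using hloc
  obtain ⟨t, ht⟩ := hKc.elim_finite_subcover U hUo fun x hx => mem_iUnion.2 ⟨⟨x, hx⟩, hxU _⟩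
  obtain ⟨ψ, hψ⟩ := SmoothPartitionOfUnity.exists_isSubordinate
    (modelWithCornersSelf ℝ (EuclideanSpace ℝ (Fin d)))
    (isClosed_closure (s := Ω)) (fun i : t => U i) (fun i => hUo i) fun x hx => by
      obtain ⟨i, hi, hxi⟩ := mem_iUnion₂.1 (ht hx)
      exact mem_iUnion.2 ⟨⟨i, hi⟩, hxi⟩
  have hψd : ∀ i, ContDiff ℝ ∞ (ψ i) := fun i => (ψ i).contMDiff.contDiff
  have hsum : ∀ x ∈ closure Ω, ∑ i, ψ i x = 1 := fun x hx => by
    rw [← ψ.sum_eq_one hx, finsum_eq_sum_of_fintype]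
  set u : t → EuclideanSpace ℝ (Fin d) → ℝ := fun i x => ψ i x * F x with hu
  have hFd : ContDiffOn ℝ 1 F Ω := hfd.congr fun x hx => hFf x (subset_closure hx)
  have hFfe : ∀ x ∈ Ω, F =ᶠ[𝓝 x] f := fun x hx =>
    Filter.eventuallyEq_of_mem (hΩo.mem_nhds hx) fun y hy => hFf y (subset_closure hy)
  have hud : ∀ i, ContDiffOn ℝ 1 (u i) Ω := fun i =>
    (((hψd i).of_le (by norm_cast)).contDiffOn).mul hFd
  have hub : ∀ i, ∃ C : ℝ, ∀ x ∈ Ω, ‖fderiv ℝ (u i) x‖ ≤ C := by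
    intro i
    have hdψ : Continuous (fderiv ℝ (ψ i)) := (hψd i).continuous_fderiv (by simp)
    obtain ⟨M1, hM1⟩ := hKc.exists_bound_of_continuousOn (f := ψ i) (hψd i).continuous.continuousOn
    obtain ⟨M2, hM2⟩ := hKc.exists_bound_of_continuousOn hdψ.continuousOn
    obtain ⟨M3, hM3⟩ := hKc.exists_bound_of_continuousOn F.continuous.continuousOn
    refine ⟨M1 * C + M3 * M2, fun x hx => ?_⟩
    have hxc := subset_closure hx
    have h1 : DifferentiableAt ℝ (ψ i) x := (hψd i).differentiable (by simp) x
    have h2 : DifferentiableAt ℝ F x :=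
      (hFd.differentiableOn one_ne_zero).differentiableAt (hΩo.mem_nhds hx)
    have h3 : fderiv ℝ (u i) x = ψ i x • fderiv ℝ F x + F x • fderiv ℝ (ψ i) x := fderiv_mul h1 h2
    rw [h3, (hFfe x hx).fderiv_eq]
    refine (norm_add_le _ _).trans (add_le_add ?_ ?_)
    · rw [norm_smul]
      exact mul_le_mul (hM1 x hxc) (hC x hx) (norm_nonneg _) ((norm_nonneg _).trans (hM1 x hxc))
    · rw [norm_smul]
      exact mul_le_mul (hM3 x hxc) (hM2 x hxc) (norm_nonneg _) ((norm_nonneg _).trans (hM3 x hxc))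
  have hmain : ∀ i : t, _ := fun i => hU i (u i) ((hψd i).continuous.mul F.continuous)
    ((closure_mono (Function.support_mul_subset_left _ _)).trans (hψ i)) (hud i) (hub i)
  have hb : (fun x => f x * inner ℝ v (outwardNormal Ω x)) =ᵐ[surfaceMeasure Ω]
      fun x => ∑ i, u i x * inner ℝ v (outwardNormal Ω x) := by
    refine (ae_restrict_iff' isClosed_frontier.measurableSet).2 (ae_of_all _ fun x hx => ?_)
    have hxc := frontier_subset_closure hx
    simp only [hu]
    rw [← Finset.sum_mul, ← Finset.sum_mul, hsum x hxc, hFf x hxc, one_mul]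
  have hv : ∀ x ∈ Ω, fderiv ℝ f x v = ∑ i, fderiv ℝ (u i) x v := by
    intro x hx
    have h1 : f =ᶠ[𝓝 x] fun y => ∑ i, u i y :=
      Filter.eventuallyEq_of_mem (hΩo.mem_nhds hx) fun y hy => by
        have hyc := subset_closure hy
        simp only [hu]
        rw [← Finset.sum_mul, hsum y hyc, hFf y hyc, one_mul]
    rw [h1.fderiv_eq, fderiv_fun_sum fun i _ =>
      ((hud i).differentiableOn one_ne_zero).differentiableAt (hΩo.mem_nhds hx)]
    simp
  have hint : ∀ i ∈ Finset.univ, IntegrableOn (fun x => fderiv ℝ (u i) x v) Ω := by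
    intro i _
    obtain ⟨M, hM⟩ := hub i
    refine integrableOn_of_continuousOn_of_bounded hΩo.measurableSet hKc (C := M * ‖v‖)
      (((hud i).continuousOn_fderiv_of_isOpen hΩo le_rfl).clm_apply continuousOn_const)
      (fun x hx h => absurd (subset_closure hx) h) fun x hx _ => ?_
    exact (ContinuousLinearMap.le_opNorm _ _).trans
      (mul_le_mul_of_nonneg_right (hM x hx) (norm_nonneg v))
  refine ⟨(integrable_finsetSum _ fun i _ => (hmain i).1).congr hb.symm, ?_⟩
  rw [integral_congr_ae hb, integral_finsetSum _ fun i _ => (hmain i).1,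
    setIntegral_congr_fun hΩo.measurableSet hv, integral_finsetSum _ hint]
  exact Finset.sum_congr rfl fun i _ => (hmain i).2

end Divergence

/-! ### Green's first identity -/

section Green

variable {d : ℕ} {Ω : Set (EuclideanSpace ℝ (Fin d))}

lemma laplacian_eq_sum_fderiv (f : EuclideanSpace ℝ (Fin d) → ℝ) (x : EuclideanSpace ℝ (Fin d)) :
    Laplacian.laplacian f x =
      ∑ i, fderiv ℝ (fderiv ℝ f) x (EuclideanSpace.basisFun (Fin d) ℝ i)
        (EuclideanSpace.basisFun (Fin d) ℝ i) := by
  rw [InnerProductSpace.laplacian_eq_iteratedFDeriv_orthonormalBasis f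
    (EuclideanSpace.basisFun (Fin d) ℝ)]
  simp [iteratedFDeriv_two_apply]

/-- Green's first identity on a bounded `C^1` domain. -/
theorem HasC1Boundary.integral_mul_normalDeriv (hΩo : IsOpen Ω) (hΩb : Bornology.IsBounded Ω)
    (hΩ : HasC1Boundary Ω) {u w : EuclideanSpace ℝ (Fin d) → ℝ}
    (hu : ContDiffOn ℝ 1 u (closure Ω)) (hw : ContDiffOn ℝ 2 w (closure Ω)) :
    ∫ x, u x * normalDeriv Ω w x ∂(surfaceMeasure Ω) =
      ∫ x in Ω, ((∑ i, fderiv ℝ u x (EuclideanSpace.basisFun (Fin d) ℝ i) *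
        fderiv ℝ w x (EuclideanSpace.basisFun (Fin d) ℝ i)) + u x * Laplacian.laplacian w x) := by
  have hud := hΩ.uniqueDiffOn_closure hΩo
  have hKc : IsCompact (closure Ω) := hΩb.isCompact_closure
  set b := EuclideanSpace.basisFun (Fin d) ℝ with hb
  have hw' : ContDiffOn ℝ 1 (fderivWithin ℝ w (closure Ω)) (closure Ω) :=
    hw.fderivWithin hud (by norm_num)
  have hnhds : ∀ x ∈ Ω, closure Ω ∈ 𝓝 x := fun x hx =>
    mem_of_superset (hΩo.mem_nhds hx) subset_closure
  set f : Fin d → EuclideanSpace ℝ (Fin d) → ℝ := fun i x =>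
    u x * fderivWithin ℝ w (closure Ω) x (b i) with hf
  have hfc : ∀ i, ContDiffOn ℝ 1 (f i) (closure Ω) := fun i =>
    hu.mul (hw'.clm_apply contDiffOn_const)
  have hbd : ∀ i, ∃ C, ∀ x ∈ Ω, ‖fderiv ℝ (f i) x‖ ≤ C := by
    intro i
    obtain ⟨C, hC⟩ := hKc.exists_bound_of_continuousOn
      ((hfc i).continuousOn_fderivWithin hud le_rfl)
    refine ⟨C, fun x hx => ?_⟩
    rw [← fderivWithin_of_mem_nhds (hnhds x hx)]
    exact hC x (subset_closure hx)
  choose C hC using hbd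
  have hdiv := fun i => hΩ.setIntegral_fderiv_eq hΩo hΩb (hfc i).continuousOn
    ((hfc i).mono subset_closure) (hC i) (b i)
  have hsurf : ∀ x, u x * normalDeriv Ω w x =
      ∑ i, f i x * inner ℝ (b i) (outwardNormal Ω x) := by
    intro x
    rw [normalDeriv]
    conv_lhs => rw [← b.sum_repr' (outwardNormal Ω x)]
    simp only [map_sum, map_smul, smul_eq_mul, Finset.mul_sum, hf]
    exact Finset.sum_congr rfl fun i _ => by ring
  have hvol : ∀ x ∈ Ω, (∑ i, fderiv ℝ u x (b i) * fderiv ℝ w x (b i)) +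
      u x * Laplacian.laplacian w x = ∑ i, fderiv ℝ (f i) x (b i) := by
    intro x hx
    rw [laplacian_eq_sum_fderiv, ← hb, Finset.mul_sum, ← Finset.sum_add_distrib]
    refine Finset.sum_congr rfl fun i _ => ?_
    have hwe : fderivWithin ℝ w (closure Ω) =ᶠ[𝓝 x] fderiv ℝ w :=
      Filter.eventuallyEq_of_mem (hΩo.mem_nhds hx) fun y hy =>
        fderivWithin_of_mem_nhds (hnhds y hy)
    have h1 : DifferentiableAt ℝ u x :=
      (hu.differentiableOn one_ne_zero).differentiableAt (hnhds x hx)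
    have h2 : DifferentiableAt ℝ (fderiv ℝ w) x :=
      ((hw'.differentiableOn one_ne_zero).differentiableAt (hnhds x hx)).congr_of_eventuallyEq
        hwe.symm
    have h3 : f i =ᶠ[𝓝 x] fun y => u y * fderiv ℝ w y (b i) :=
      hwe.mono fun y hy => by simp only [hf, hy]
    have h4 := h1.hasFDerivAt.mul (h2.hasFDerivAt.clm_apply (hasFDerivAt_const (b i) x))
    rw [h3.fderiv_eq]
    change _ = fderiv ℝ (u * fun y => fderiv ℝ w y (b i)) x (b i)
    rw [h4.fderiv]
    simp
    ring
  have hint : ∀ i ∈ Finset.univ, IntegrableOn (fun x => fderiv ℝ (f i) x (b i)) Ω := by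
    intro i _
    refine integrableOn_of_continuousOn_of_bounded hΩo.measurableSet hKc (C := C i * ‖b i‖)
      ((((hfc i).mono subset_closure).continuousOn_fderiv_of_isOpen hΩo le_rfl).clm_apply
        continuousOn_const) (fun x hx h => absurd (subset_closure hx) h) fun x hx _ => ?_
    exact (ContinuousLinearMap.le_opNorm _ _).trans
      (mul_le_mul_of_nonneg_right (hC i x hx) (norm_nonneg _))
  simp only [hsurf]
  rw [integral_finsetSum _ fun i _ => (hdiv i).1, setIntegral_congr_fun hΩo.measurableSet hvol,
    integral_finsetSum _ hint]
  exact Finset.sum_congr rfl fun i _ => (hdiv i).2.symm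

end Green

/-! ### Integration by parts in time -/

section Time

/-- Exchange of the order of integration over the triangle `0 ≤ s ≤ t ≤ T`. -/
lemma integral_integral_triangle_swap {H : ℝ → ℝ → ℝ} (hH : Continuous (Function.uncurry H))
    {T : ℝ} (hT : 0 ≤ T) :
    ∫ t in (0 : ℝ)..T, ∫ s in (0 : ℝ)..t, H t s = ∫ s in (0 : ℝ)..T, ∫ t in s..T, H t s := by
  set F : ℝ → ℝ → ℝ := fun t s => if s ≤ t then H t s else 0 with hF
  have hset : MeasurableSet {p : ℝ × ℝ | p.2 ≤ p.1} :=
    (isClosed_le continuous_snd continuous_fst).measurableSet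
  have hFi : Function.uncurry F = {p : ℝ × ℝ | p.2 ≤ p.1}.indicator (Function.uncurry H) := by
    ext ⟨t, s⟩
    simp [hF, Function.uncurry, indicator]
  have hint : IntegrableOn (Function.uncurry F) (uIoc 0 T ×ˢ uIoc 0 T) := by
    rw [hFi, uIoc_of_le hT]
    refine IntegrableOn.indicator ?_ hset
    exact (hH.continuousOn.integrableOn_compact (isCompact_Icc.prod isCompact_Icc)).mono_set
      (prod_mono Ioc_subset_Icc_self Ioc_subset_Icc_self)
  have h1 : ∀ t ∈ uIcc 0 T, ∫ s in (0 : ℝ)..t, H t s = ∫ s in (0 : ℝ)..T, F t s := by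
    intro t ht
    rw [uIcc_of_le hT] at ht
    rw [intervalIntegral.integral_of_le ht.1, intervalIntegral.integral_of_le hT]
    symm
    rw [setIntegral_eq_of_subset_of_forall_sdiff_eq_zero measurableSet_Ioc
      (Ioc_subset_Ioc_right ht.2)]
    · exact setIntegral_congr_fun measurableSet_Ioc fun s hs => if_pos hs.2
    · exact fun s hs => if_neg fun h => hs.2 ⟨hs.1.1, h⟩
  have h2 : ∀ s ∈ uIcc 0 T, ∫ t in s..T, H t s = ∫ t in (0 : ℝ)..T, F t s := by
    intro s hs
    rw [uIcc_of_le hT] at hs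
    rw [intervalIntegral.integral_of_le hs.2, intervalIntegral.integral_of_le hT,
      ← integral_Icc_eq_integral_Ioc, ← integral_Icc_eq_integral_Ioc]
    symm
    rw [setIntegral_eq_of_subset_of_forall_sdiff_eq_zero measurableSet_Icc
      (Icc_subset_Icc_left hs.1)]
    · exact setIntegral_congr_fun measurableSet_Icc fun t ht => if_pos ht.1
    · exact fun t ht => if_neg fun h => ht.2 ⟨h, ht.1.2⟩
  rw [intervalIntegral.integral_congr h1, intervalIntegral.integral_congr h2]
  exact intervalIntegral_intervalIntegral_swap hint

/-- Integration by parts for the convolution operators with kernel `k`. After the substitution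
`s = t - τ` and an exchange of integrals this is, for each lag `s`, ordinary integration by
parts on `[s, T]`. -/
theorem integral_conv_deriv_mul {u w k : ℝ → ℝ} (hu : ContDiff ℝ 1 u) (hw : ContDiff ℝ 1 w)
    (hk : Continuous k) {T : ℝ} (hT : 0 ≤ T) :
    ∫ t in (0 : ℝ)..T, (∫ τ in (0 : ℝ)..t, deriv u τ * k (t - τ)) * w t =
      w T * (∫ t in (0 : ℝ)..T, u t * k (T - t)) - (∫ t in (0 : ℝ)..T, u 0 * k t * w t) -
        ∫ t in (0 : ℝ)..T, u t * ∫ τ in t..T, deriv w τ * k (τ - t) := by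
  have hu' : Continuous (deriv u) := hu.continuous_deriv le_rfl
  have hw' : Continuous (deriv w) := hw.continuous_deriv le_rfl
  have huc := hu.continuous
  have hwc := hw.continuous
  have hsub : ∀ t, ∫ τ in (0 : ℝ)..t, deriv u τ * k (t - τ) =
      ∫ s in (0 : ℝ)..t, deriv u (t - s) * k s := by
    intro t
    have := intervalIntegral.integral_comp_sub_left (a := 0) (b := t)
      (fun s => deriv u (t - s) * k s) t
    simpa using this
  have hsub2 : ∫ t in (0 : ℝ)..T, u t * k (T - t) = ∫ s in (0 : ℝ)..T, u (T - s) * k s := by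
    have := intervalIntegral.integral_comp_sub_left (a := 0) (b := T)
      (fun s => u (T - s) * k s) T
    simpa using this
  have hL : ∫ t in (0 : ℝ)..T, (∫ τ in (0 : ℝ)..t, deriv u τ * k (t - τ)) * w t =
      ∫ s in (0 : ℝ)..T, k s * ∫ t in s..T, w t * deriv u (t - s) := by
    simp only [hsub, ← intervalIntegral.integral_mul_const, ← intervalIntegral.integral_const_mul]
    rw [integral_integral_triangle_swap (H := fun t s => deriv u (t - s) * k s * w t)
      (by unfold Function.uncurry; fun_prop) hT]
    congr! 4
    ring
  have hR : ∫ t in (0 : ℝ)..T, u t * ∫ τ in t..T, deriv w τ * k (τ - t) =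
      ∫ s in (0 : ℝ)..T, k s * ∫ t in s..T, deriv w t * u (t - s) := by
    simp only [← intervalIntegral.integral_const_mul]
    rw [← integral_integral_triangle_swap (H := fun τ t => u t * (deriv w τ * k (τ - t)))
      (by unfold Function.uncurry; fun_prop) hT,
      ← integral_integral_triangle_swap (H := fun t s => k s * (deriv w t * u (t - s)))
      (by unfold Function.uncurry; fun_prop) hT]
    refine intervalIntegral.integral_congr fun τ _ => ?_
    have := intervalIntegral.integral_comp_sub_left (a := 0) (b := τ)
      (fun s => k s * (deriv w τ * u (τ - s))) τ
    simp only [sub_sub_cancel, sub_self, sub_zero] at this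
    rw [← this]
    congr! 2
    ring
  have hparts : ∀ s, ∫ t in s..T, w t * deriv u (t - s) =
      w T * u (T - s) - w s * u 0 - ∫ t in s..T, deriv w t * u (t - s) := by
    intro s
    have h1 : ∀ t ∈ uIcc s T, HasDerivAt w (deriv w t) t := fun t _ =>
      (hw.differentiable one_ne_zero t).hasDerivAt
    have h2 : ∀ t ∈ uIcc s T, HasDerivAt (fun t => u (t - s)) (deriv u (t - s)) t := fun t _ => by
      have h3 : HasDerivAt u (deriv u (t - s)) (t - s) :=
        (hu.differentiable one_ne_zero _).hasDerivAt
      exact h3.comp_sub_const t s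
    have := intervalIntegral.integral_mul_deriv_eq_deriv_mul h1 h2
      (hw'.intervalIntegrable _ _) (Continuous.intervalIntegrable (by fun_prop) _ _)
    simpa using this
  have hI : Continuous fun s => ∫ t in s..T, deriv w t * u (t - s) := by
    have : Continuous fun s => ∫ t in T..s, deriv w t * u (t - s) :=
      intervalIntegral.continuous_parametric_intervalIntegral_of_continuous
        (by unfold Function.uncurry; fun_prop) continuous_id
    exact this.neg.congr fun s => (intervalIntegral.integral_symm T s).symm
  rw [hL, hR, hsub2, ← intervalIntegral.integral_const_mul, ← intervalIntegral.integral_sub,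
    ← intervalIntegral.integral_sub]
  · refine intervalIntegral.integral_congr fun s _ => ?_
    rw [hparts s]
    ring
  all_goals exact Continuous.intervalIntegrable (by fun_prop) _ _

end Time

/-! ### Continuity of the Mittag-Leffler kernel -/

section Kernel

/-- Restricting Euler's integral to `x > M` bounds the Gamma function below by exponentials. -/
lemma rpow_mul_exp_neg_le_Gamma_add_one {s M : ℝ} (hs : 0 ≤ s) (hM : 0 < M) :
    M ^ s * Real.exp (-M) ≤ Real.Gamma (s + 1) := by
  rw [Real.Gamma_eq_integral (by linarith), add_sub_cancel_right]
  have hI : IntegrableOn (fun x : ℝ => Real.exp (-x) * x ^ s) (Ioi 0) := by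
    simpa using Real.GammaIntegral_convergent (s := s + 1) (by linarith)
  have hI' : IntegrableOn (fun x : ℝ => M ^ s * Real.exp (-x)) (Ioi M) :=
    (integrableOn_exp_neg_Ioi M).const_mul _
  calc M ^ s * Real.exp (-M) = ∫ x in Ioi M, M ^ s * Real.exp (-x) := by
        rw [integral_const_mul, integral_exp_neg_Ioi]
    _ ≤ ∫ x in Ioi M, Real.exp (-x) * x ^ s := by
        refine setIntegral_mono_on hI' (hI.mono_set (Ioi_subset_Ioi hM.le)) measurableSet_Ioi ?_
        intro x hx
        rw [mul_comm]
        exact mul_le_mul_of_nonneg_left (Real.rpow_le_rpow hM.le (le_of_lt hx) hs)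
          (Real.exp_nonneg _)
    _ ≤ _ := by
        refine setIntegral_mono_set hI ?_ (Ioi_subset_Ioi hM.le).eventuallyLE
        refine (ae_restrict_iff' measurableSet_Ioi).2 (ae_of_all _ fun x hx => ?_)
        exact mul_nonneg (Real.exp_nonneg _) (Real.rpow_nonneg (le_of_lt hx) _)

lemma summable_pow_div_Gamma {α : ℝ} (hα : 0 < α) {R : ℝ} (hR : 0 ≤ R) :
    Summable fun k : ℕ => R ^ k / Real.Gamma (k * α + 1) := by
  -- `M` makes `R / M ^ α` at most `1 / 2`, so the series is dominated by a geometric one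
  set M : ℝ := (2 * (R + 1)) ^ α⁻¹ with hM
  have hM0 : 0 < M := by positivity
  have hMα : M ^ α = 2 * (R + 1) := by
    rw [hM, ← Real.rpow_mul (by positivity), inv_mul_cancel₀ hα.ne', Real.rpow_one]
  have hgeo : Summable fun k : ℕ => Real.exp M * (1 / 2 : ℝ) ^ k :=
    (summable_geometric_of_lt_one (by norm_num) (by norm_num)).mul_left _
  refine Summable.of_nonneg_of_le (fun k => ?_) (fun k => ?_) hgeo
  · exact div_nonneg (pow_nonneg hR k) (Real.Gamma_nonneg_of_nonneg (by positivity))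
  · have h1 := rpow_mul_exp_neg_le_Gamma_add_one (s := k * α) (by positivity) hM0
    have h2 : M ^ ((k : ℝ) * α) = (2 * (R + 1)) ^ k := by
      rw [mul_comm, Real.rpow_mul hM0.le, hMα, Real.rpow_natCast]
    rw [h2] at h1
    rw [div_le_iff₀ (Real.Gamma_pos_of_pos (by positivity))]
    calc R ^ k ≤ (R + 1) ^ k := by gcongr; linarith
      _ = Real.exp M * (1 / 2) ^ k * ((2 * (R + 1)) ^ k * Real.exp (-M)) := by
          rw [Real.exp_neg, mul_pow]
          field_simp
          rw [← mul_pow]; norm_num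
      _ ≤ _ := by gcongr

lemma continuous_mittagLeffler {α : ℝ} (hα : 0 < α) : Continuous (mittagLeffler α 1) := by
  rw [continuous_iff_continuousAt]
  intro z
  have h : ContinuousOn (mittagLeffler α 1) (Metric.ball 0 (|z| + 1)) := by
    unfold mittagLeffler
    refine continuousOn_tsum (fun k => by fun_prop)
      (summable_pow_div_Gamma hα (R := |z| + 1) (by positivity)) fun k x hx => ?_
    rw [norm_div, norm_pow, Real.norm_of_nonneg
      (Real.Gamma_nonneg_of_nonneg (s := k * α + 1) (by positivity))]
    have hx' : ‖x‖ ≤ |z| + 1 := by simpa using (Metric.mem_ball.1 hx).le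
    have := Real.Gamma_nonneg_of_nonneg (s := k * α + 1) (by positivity)
    gcongr
  exact h.continuousAt (Metric.isOpen_ball.mem_nhds (by simp))

lemma continuous_abKernel {α : ℝ} (hα : 0 < α) : Continuous (abKernel α) := by
  unfold abKernel
  exact (continuous_mittagLeffler hα).comp
    (continuous_const.mul (Real.continuous_rpow_const hα.le))

end Kernel

/-! ### Regularity on the closed cylinder -/

section Cylinder

variable {d : ℕ} {Ω : Set (EuclideanSpace ℝ (Fin d))} {T : ℝ}

lemma closure_cylinder (hT : 0 < T) :
    closure (Ω ×ˢ Ioo 0 T) = closure Ω ×ˢ Icc 0 T := by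
  rw [closure_prod_eq, closure_Ioo hT.ne]

lemma HasC1Boundary.uniqueDiffOn_closure_cylinder (hΩo : IsOpen Ω) (hΩ : HasC1Boundary Ω)
    (hT : 0 < T) : UniqueDiffOn ℝ (closure (Ω ×ˢ Ioo 0 T)) := by
  rw [closure_cylinder hT]
  exact (hΩ.uniqueDiffOn_closure hΩo).prod (uniqueDiffOn_Icc hT)

lemma closure_cylinder_mem_nhds (hΩo : IsOpen Ω) {x : EuclideanSpace ℝ (Fin d)} {t : ℝ}
    (hx : x ∈ Ω) (ht : t ∈ Ioo 0 T) : closure (Ω ×ˢ Ioo 0 T) ∈ 𝓝 (x, t) :=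
  mem_of_superset ((hΩo.prod isOpen_Ioo).mem_nhds ⟨hx, ht⟩) subset_closure

/-- A function continuous on a closed set is the restriction of a continuous function. -/
lemma exists_continuous_eqOn {X : Type*} [TopologicalSpace X] [NormalSpace X] {s : Set X}
    (hs : IsClosed s) {f : X → ℝ} (hf : ContinuousOn f s) :
    ∃ F : X → ℝ, Continuous F ∧ EqOn F f s := by
  obtain ⟨F, hF⟩ := ContinuousMap.exists_restrict_eq hs
    (⟨s.domRestrict f, continuousOn_iff_continuous_domRestrict.1 hf⟩ : C(s, ℝ))
  exact ⟨F, F.continuous, fun x hx => congrArg (fun k => k ⟨x, hx⟩) hF⟩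

section Slices

variable {F : Type*} [NormedAddCommGroup F] [NormedSpace ℝ F]
  {G : EuclideanSpace ℝ (Fin d) × ℝ → F}

lemma hasFDerivAt_slice_left (hΩo : IsOpen Ω)
    (hG : DifferentiableOn ℝ G (closure (Ω ×ˢ Ioo 0 T))) {x : EuclideanSpace ℝ (Fin d)} {t : ℝ}
    (hx : x ∈ Ω) (ht : t ∈ Ioo 0 T) :
    HasFDerivAt (fun z => G (z, t)) ((fderivWithin ℝ G (closure (Ω ×ˢ Ioo 0 T)) (x, t)).comp
      (ContinuousLinearMap.inl ℝ _ ℝ)) x := by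
  have hn := closure_cylinder_mem_nhds hΩo hx ht
  have h1 := (hG.differentiableAt hn).hasFDerivAt
  rw [← fderivWithin_of_mem_nhds hn] at h1
  exact HasFDerivAt.comp (f := fun z => (z, t)) x h1 (hasFDerivAt_prodMk_left x t)

lemma hasDerivAt_slice_right (hΩo : IsOpen Ω)
    (hG : DifferentiableOn ℝ G (closure (Ω ×ˢ Ioo 0 T))) {x : EuclideanSpace ℝ (Fin d)} {t : ℝ}
    (hx : x ∈ Ω) (ht : t ∈ Ioo 0 T) :
    HasDerivAt (fun s => G (x, s)) (fderivWithin ℝ G (closure (Ω ×ˢ Ioo 0 T)) (x, t) (0, 1)) t := by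
  have hn := closure_cylinder_mem_nhds hΩo hx ht
  have h1 := (hG.differentiableAt hn).hasFDerivAt
  rw [← fderivWithin_of_mem_nhds hn] at h1
  exact h1.comp_hasDerivAt t ((hasDerivAt_const t x).prodMk (hasDerivAt_id t))

end Slices

/-- A function smooth on the closed cylinder, together with its time derivative, its spatial
gradient and its spatial Laplacian, agrees on the cylinder with continuous functions on the whole
space-time. -/
structure CylinderExtension {d : ℕ} (Ω : Set (EuclideanSpace ℝ (Fin d))) (T : ℝ)
    (y : EuclideanSpace ℝ (Fin d) → ℝ → ℝ) where
  /-- extension of the function -/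
  val : EuclideanSpace ℝ (Fin d) × ℝ → ℝ
  /-- extension of the time derivative -/
  dt : EuclideanSpace ℝ (Fin d) × ℝ → ℝ
  /-- extension of the spatial partial derivatives -/
  dx : Fin d → EuclideanSpace ℝ (Fin d) × ℝ → ℝ
  /-- extension of the spatial Laplacian -/
  lap : EuclideanSpace ℝ (Fin d) × ℝ → ℝ
  continuous_val : Continuous val
  continuous_dt : Continuous dt
  continuous_dx : ∀ i, Continuous (dx i)
  continuous_lap : Continuous lap
  val_eq : ∀ x ∈ closure Ω, ∀ t ∈ Icc 0 T, y x t = val (x, t)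
  dt_eq : ∀ x ∈ Ω, ∀ t ∈ Ioo 0 T, HasDerivAt (y x) (dt (x, t)) t
  dx_eq : ∀ x ∈ Ω, ∀ t ∈ Ioo 0 T, ∀ i,
    fderiv ℝ (fun z => y z t) x (EuclideanSpace.basisFun (Fin d) ℝ i) = dx i (x, t)
  lap_eq : ∀ x ∈ Ω, ∀ t ∈ Ioo 0 T, Laplacian.laplacian (fun z => y z t) x = lap (x, t)
  contDiffOn : ∀ t ∈ Icc 0 T, ContDiffOn ℝ 2 (fun z => y z t) (closure Ω)

/-- On the closed cylinder the derivatives are those within the closed set, which are continuous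
there because the set has unique derivatives; Tietze's theorem extends them. -/
lemma HasC1Boundary.nonempty_cylinderExtension (hΩo : IsOpen Ω) (hΩ : HasC1Boundary Ω)
    (hT : 0 < T) {y : EuclideanSpace ℝ (Fin d) → ℝ → ℝ}
    (hy : ContDiffOn ℝ ∞ (Function.uncurry y) (closure (Ω ×ˢ Ioo 0 T))) :
    Nonempty (CylinderExtension Ω T y) := by
  set K := closure (Ω ×ˢ Ioo 0 T) with hK
  have hKe : K = closure Ω ×ˢ Icc 0 T := closure_cylinder hT
  have hKcl : IsClosed K := isClosed_closure
  have hQK : ∀ x ∈ Ω, ∀ t ∈ Ioo 0 T, (x, t) ∈ K := fun x hx t ht => subset_closure ⟨hx, ht⟩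
  have hud : UniqueDiffOn ℝ K := hΩ.uniqueDiffOn_closure_cylinder hΩo hT
  set b := EuclideanSpace.basisFun (Fin d) ℝ with hb
  have hD1 : ContDiffOn ℝ ∞ (fderivWithin ℝ (Function.uncurry y) K) K :=
    hy.fderivWithin hud (by simp)
  have hD2 : ContDiffOn ℝ ∞ (fderivWithin ℝ (fderivWithin ℝ (Function.uncurry y) K) K) K :=
    hD1.fderivWithin hud (by simp)
  have hyd : DifferentiableOn ℝ (Function.uncurry y) K := hy.differentiableOn (by simp)
  have hD1d : DifferentiableOn ℝ (fderivWithin ℝ (Function.uncurry y) K) K :=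
    hD1.differentiableOn (by simp)
  obtain ⟨Y0, hY0c, hY0⟩ := exists_continuous_eqOn hKcl hy.continuousOn
  obtain ⟨Yt, hYtc, hYt⟩ := exists_continuous_eqOn hKcl
    (hD1.continuousOn.clm_apply (continuousOn_const (c := ((0 : EuclideanSpace ℝ (Fin d)), (1 : ℝ)))))
  have hx := fun i => exists_continuous_eqOn hKcl
    (hD1.continuousOn.clm_apply (continuousOn_const (c := (b i, (0 : ℝ)))))
  choose Yx hYxc hYx using hx
  obtain ⟨YL, hYLc, hYL⟩ := exists_continuous_eqOn hKcl (f := fun p => ∑ i,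
      fderivWithin ℝ (fderivWithin ℝ (Function.uncurry y) K) K p (b i, 0) (b i, 0))
    (continuousOn_finsetSum _ fun i _ =>
      (hD2.continuousOn.clm_apply continuousOn_const).clm_apply continuousOn_const)
  have hfd : ∀ x ∈ Ω, ∀ t ∈ Ioo 0 T, HasFDerivAt (fun z => y z t)
      ((fderivWithin ℝ (Function.uncurry y) K (x, t)).comp (ContinuousLinearMap.inl ℝ _ ℝ)) x :=
    fun x hx t ht => hasFDerivAt_slice_left hΩo hyd hx ht
  refine ⟨⟨Y0, Yt, Yx, YL, hY0c, hYtc, hYxc, hYLc, ?_, ?_, ?_, ?_, ?_⟩⟩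
  · intro x hx t ht
    exact (hY0 (show (x, t) ∈ K by rw [hKe]; exact ⟨hx, ht⟩)).symm
  · intro x hx t ht
    rw [hYt (hQK x hx t ht)]
    exact hasDerivAt_slice_right hΩo hyd hx ht
  · intro x hx t ht i
    rw [hYx i (hQK x hx t ht), (hfd x hx t ht).fderiv]
    simp [hb]
  · intro x hx t ht
    rw [hYL (hQK x hx t ht), laplacian_eq_sum_fderiv]
    have he : fderiv ℝ (fun z => y z t) =ᶠ[𝓝 x] fun z =>
        (fderivWithin ℝ (Function.uncurry y) K (z, t)).comp (ContinuousLinearMap.inl ℝ _ ℝ) :=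
      Filter.eventuallyEq_of_mem (hΩo.mem_nhds hx) fun z hz => (hfd z hz t ht).fderiv
    have h1 := (hasFDerivAt_slice_left hΩo hD1d hx ht).clm_comp
      (hasFDerivAt_const (ContinuousLinearMap.inl ℝ (EuclideanSpace ℝ (Fin d)) ℝ) x)
    rw [← hK] at h1
    rw [he.fderiv_eq, h1.fderiv]
    simp [hb]
  · intro t ht
    have h1 : ContDiffOn ℝ 2 (Function.uncurry y) K := hy.of_le (by norm_cast)
    refine h1.comp (f := fun z => (z, t)) (contDiff_prodMk_left t).contDiffOn fun z hz => ?_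
    rw [hKe]
    exact ⟨hz, ht⟩

end Cylinder

/-! ### Integration over the space-time cylinder -/

section SpaceTime

variable {d : ℕ} {Ω : Set (EuclideanSpace ℝ (Fin d))} {T : ℝ}
  {y φ : EuclideanSpace ℝ (Fin d) → ℝ → ℝ}

/-- On `[0, T]` the slice `y x` agrees with a function that is `C^1` on the whole line and has
the extended time derivative. -/
lemma CylinderExtension.exists_contDiff_slice (Y : CylinderExtension Ω T y)
    {x : EuclideanSpace ℝ (Fin d)} (hx : x ∈ Ω) :
    ∃ u : ℝ → ℝ, ContDiff ℝ 1 u ∧ (∀ t, deriv u t = Y.dt (x, t)) ∧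
      ∀ t ∈ Icc 0 T, u t = Y.val (x, t) := by
  have hc : Continuous fun t => Y.dt (x, t) := Y.continuous_dt.comp (by fun_prop)
  have hv : Continuous fun t => Y.val (x, t) := Y.continuous_val.comp (by fun_prop)
  set u : ℝ → ℝ := fun t => Y.val (x, 0) + ∫ τ in (0 : ℝ)..t, Y.dt (x, τ) with hu
  have hd : ∀ t, HasDerivAt u (Y.dt (x, t)) t := fun t =>
    (intervalIntegral.integral_hasDerivAt_right (hc.intervalIntegrable _ _)
      hc.stronglyMeasurable.stronglyMeasurableAtFilter hc.continuousAt).const_add _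
  have hdu : deriv u = fun t => Y.dt (x, t) := funext fun t => (hd t).deriv
  refine ⟨u, contDiff_one_iff_deriv.2 ⟨fun t => (hd t).differentiableAt, hdu ▸ hc⟩,
    fun t => (hd t).deriv, fun t ht => ?_⟩
  have hxc := subset_closure hx
  have h1 := intervalIntegral.integral_eq_sub_of_hasDerivAt_of_le (f := fun t => Y.val (x, t))
    ht.1 hv.continuousOn (fun s hs => ?_) (hc.intervalIntegrable 0 t)
  · simp only [hu, h1]; ring
  · have hsT : s ∈ Ioo 0 T := ⟨hs.1, hs.2.trans_le ht.2⟩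
    refine (Y.dt_eq x hx s hsT).congr_of_eventuallyEq ?_
    exact Filter.eventuallyEq_of_mem (isOpen_Ioo.mem_nhds hsT) fun r hr =>
      (Y.val_eq x hxc r (Ioo_subset_Icc_self hr)).symm

lemma CylinderExtension.abcLeft_eq (Y : CylinderExtension Ω T y) (α : ℝ)
    {x : EuclideanSpace ℝ (Fin d)} (hx : x ∈ Ω) {t : ℝ} (ht : t ∈ Icc 0 T) :
    abcLeft α 0 (y x) t =
      abNorm α / (1 - α) * ∫ τ in (0 : ℝ)..t, Y.dt (x, τ) * abKernel α (t - τ) := by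
  rw [abcLeft]
  congr 1
  refine intervalIntegral.integral_congr_Ioo_of_le ht.1 fun τ hτ => ?_
  rw [(Y.dt_eq x hx τ ⟨hτ.1, hτ.2.trans_le ht.2⟩).deriv]

lemma CylinderExtension.abcRight_eq (Y : CylinderExtension Ω T y) (α : ℝ)
    {x : EuclideanSpace ℝ (Fin d)} (hx : x ∈ Ω) {t : ℝ} (ht : t ∈ Icc 0 T) :
    abcRight α T (y x) t =
      -(abNorm α / (1 - α)) * ∫ τ in t..T, Y.dt (x, τ) * abKernel α (τ - t) := by
  rw [abcRight]
  congr 1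
  refine intervalIntegral.integral_congr_Ioo_of_le ht.2 fun τ hτ => ?_
  rw [(Y.dt_eq x hx τ ⟨ht.1.trans_lt hτ.1, hτ.2⟩).deriv]

/-- The time part of the identity at a fixed point of `Ω`. -/
lemma CylinderExtension.integral_conv_dt_mul (Y : CylinderExtension Ω T y)
    (Φ : CylinderExtension Ω T φ) (hT : 0 ≤ T) {k : ℝ → ℝ} (hk : Continuous k)
    {x : EuclideanSpace ℝ (Fin d)} (hx : x ∈ Ω) :
    ∫ t in (0 : ℝ)..T, (∫ τ in (0 : ℝ)..t, Y.dt (x, τ) * k (t - τ)) * Φ.val (x, t) =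
      Φ.val (x, T) * (∫ t in (0 : ℝ)..T, Y.val (x, t) * k (T - t)) -
        (∫ t in (0 : ℝ)..T, Y.val (x, 0) * k t * Φ.val (x, t)) -
        ∫ t in (0 : ℝ)..T, Y.val (x, t) * ∫ τ in t..T, Φ.dt (x, τ) * k (τ - t) := by
  obtain ⟨u, hu, hud, huv⟩ := Y.exists_contDiff_slice hx
  obtain ⟨w, hw, hwd, hwv⟩ := Φ.exists_contDiff_slice hx
  have h := integral_conv_deriv_mul hu hw hk hT
  simp only [hud, hwd] at h
  have hI := uIcc_of_le hT
  have hcongr : ∀ {p q : ℝ → ℝ}, (∀ t ∈ Icc 0 T, p t = q t) →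
      ∫ t in (0 : ℝ)..T, p t = ∫ t in (0 : ℝ)..T, q t := fun hpq =>
    intervalIntegral.integral_congr fun t ht => hpq t (hI ▸ ht)
  rw [hwv T ⟨hT, le_rfl⟩, huv 0 ⟨le_rfl, hT⟩] at h
  refine Eq.trans (hcongr fun t ht => by rw [hwv t ht]) (h.trans ?_)
  refine congrArg₂ _ (congrArg₂ _ (congrArg _ (hcongr fun t ht => ?_)) (hcongr fun t ht => ?_))
    (hcongr fun t ht => ?_)
  · rw [huv t ht]
  · rw [hwv t ht]
  · rw [huv t ht]

lemma integrableOn_intervalIntegral (hΩb : Bornology.IsBounded Ω)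
    {G : EuclideanSpace ℝ (Fin d) × ℝ → ℝ} (hG : Continuous G) (a b : ℝ) :
    IntegrableOn (fun x => ∫ t in a..b, G (x, t)) Ω := by
  have h1 : Continuous fun x => ∫ t in a..b, G (x, t) :=
    intervalIntegral.continuous_parametric_intervalIntegral_of_continuous'
      (f := fun x t => G (x, t)) hG a b
  exact (h1.continuousOn.integrableOn_compact hΩb.isCompact_closure).mono_set subset_closure

lemma integrableOn_slice (hΩb : Bornology.IsBounded Ω)
    {G : EuclideanSpace ℝ (Fin d) × ℝ → ℝ} (hG : Continuous G) (t : ℝ) :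
    IntegrableOn (fun x => G (x, t)) Ω := by
  have h1 : Continuous fun x => G (x, t) := hG.comp (by fun_prop)
  exact (h1.continuousOn.integrableOn_compact hΩb.isCompact_closure).mono_set subset_closure

lemma integrable_cylinder (hΩb : Bornology.IsBounded Ω)
    {G : EuclideanSpace ℝ (Fin d) × ℝ → ℝ} (hG : Continuous G) (a b : ℝ) :
    Integrable G ((volume.restrict Ω).prod (volume.restrict (uIoc a b))) := by
  rw [Measure.prod_restrict]
  exact (hG.continuousOn.integrableOn_compact
    (hΩb.isCompact_closure.prod isCompact_uIcc)).mono_set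
      (prod_mono subset_closure uIoc_subset_uIcc)

lemma intervalIntegrable_setIntegral (hΩb : Bornology.IsBounded Ω)
    {G : EuclideanSpace ℝ (Fin d) × ℝ → ℝ} (hG : Continuous G) (a b : ℝ) :
    IntervalIntegrable (fun t => ∫ x in Ω, G (x, t)) volume a b := by
  rw [intervalIntegrable_iff]
  exact (integrable_cylinder hΩb hG a b).integral_prod_right

lemma setIntegral_intervalIntegral_swap (hΩb : Bornology.IsBounded Ω)
    {G : EuclideanSpace ℝ (Fin d) × ℝ → ℝ} (hG : Continuous G) (a b : ℝ) :
    ∫ x in Ω, ∫ t in a..b, G (x, t) = ∫ t in a..b, ∫ x in Ω, G (x, t) :=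
  (intervalIntegral_integral_swap (f := fun t x => G (x, t))
    (integrable_cylinder hΩb hG a b).swap).symm

/-- Green's first identity on a time slice, with the integrands replaced by their extensions. -/
lemma CylinderExtension.integral_mul_normalDeriv (hΩo : IsOpen Ω) (hΩb : Bornology.IsBounded Ω)
    (hΩ : HasC1Boundary Ω) (Y : CylinderExtension Ω T y) (Φ : CylinderExtension Ω T φ)
    {t : ℝ} (ht : t ∈ Ioo 0 T) :
    ∫ x, y x t * normalDeriv Ω (fun z => φ z t) x ∂(surfaceMeasure Ω) =
      (∫ x in Ω, ∑ i, Y.dx i (x, t) * Φ.dx i (x, t)) +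
        ∫ x in Ω, Y.val (x, t) * Φ.lap (x, t) := by
  have htI := Ioo_subset_Icc_self ht
  rw [hΩ.integral_mul_normalDeriv hΩo hΩb ((Y.contDiffOn t htI).of_le (by norm_num))
    (Φ.contDiffOn t htI), ← integral_add]
  · refine setIntegral_congr_fun hΩo.measurableSet fun x hx => ?_
    simp only [Y.dx_eq x hx t ht, Φ.dx_eq x hx t ht, Φ.lap_eq x hx t ht,
      Y.val_eq x (subset_closure hx) t htI]
  · have hY := Y.continuous_dx
    have hΦ := Φ.continuous_dx
    exact integrableOn_slice (G := fun p => ∑ i, Y.dx i p * Φ.dx i p) hΩb (by fun_prop) t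
  · exact integrableOn_slice (G := fun p => Y.val p * Φ.lap p) hΩb
      (Y.continuous_val.mul Φ.continuous_lap) t

/-- Green's second identity integrated over time: the products of gradients cancel. -/
lemma CylinderExtension.green_second (hΩo : IsOpen Ω) (hΩb : Bornology.IsBounded Ω)
    (hΩ : HasC1Boundary Ω) (hT : 0 < T) (Y : CylinderExtension Ω T y)
    (Φ : CylinderExtension Ω T φ) :
    (∫ t in (0 : ℝ)..T, ∫ x, y x t * normalDeriv Ω (fun z => φ z t) x ∂(surfaceMeasure Ω))
      - (∫ t in (0 : ℝ)..T, ∫ x, φ x t * normalDeriv Ω (fun z => y z t) x ∂(surfaceMeasure Ω)) =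
      (∫ x in Ω, ∫ t in (0 : ℝ)..T, Y.val (x, t) * Φ.lap (x, t)) -
        ∫ x in Ω, ∫ t in (0 : ℝ)..T, Φ.val (x, t) * Y.lap (x, t) := by
  have hYx := Y.continuous_dx
  have hΦx := Φ.continuous_dx
  have hG : Continuous fun p => ∑ i, Y.dx i p * Φ.dx i p := by fun_prop
  have h1 : Continuous fun p => Y.val p * Φ.lap p := Y.continuous_val.mul Φ.continuous_lap
  have h2 : Continuous fun p => Φ.val p * Y.lap p := Φ.continuous_val.mul Y.continuous_lap
  rw [intervalIntegral.integral_congr_Ioo_of_le hT.le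
      fun t ht => Y.integral_mul_normalDeriv hΩo hΩb hΩ Φ ht,
    intervalIntegral.integral_congr_Ioo_of_le hT.le
      fun t ht => Φ.integral_mul_normalDeriv hΩo hΩb hΩ Y ht,
    intervalIntegral.integral_add (intervalIntegrable_setIntegral hΩb hG 0 T)
      (intervalIntegrable_setIntegral hΩb h1 0 T)]
  simp only [mul_comm (Φ.dx _ _)]
  rw [intervalIntegral.integral_add (intervalIntegrable_setIntegral hΩb hG 0 T)
      (intervalIntegrable_setIntegral hΩb h2 0 T),
    setIntegral_intervalIntegral_swap hΩb h1, setIntegral_intervalIntegral_swap hΩb h2]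
  ring

end SpaceTime

/-! ### The integration by parts formula -/

theorem mainTheorem6 {d : ℕ} (hd : 1 ≤ d) (Ω : Set (EuclideanSpace ℝ (Fin d)))
    (hΩo : IsOpen Ω) (hΩb : Bornology.IsBounded Ω) (hΩ : HasC1Boundary Ω)
    (T : ℝ) (hT : 0 < T) (α : ℝ) (hα0 : 0 < α) (hα1 : α < 1)
    (y φ : EuclideanSpace ℝ (Fin d) → ℝ → ℝ)
    (hy : ContDiffOn ℝ ∞ (Function.uncurry y) (closure (Ω ×ˢ Ioo 0 T)))
    (hφ : ContDiffOn ℝ ∞ (Function.uncurry φ) (closure (Ω ×ˢ Ioo 0 T))) :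
    (∫ x in Ω, ∫ t in (0 : ℝ)..T,
        (abcLeft α 0 (y x) t - Laplacian.laplacian (fun z => y z t) x) * φ x t) =
      (∫ t in (0 : ℝ)..T, ∫ x, y x t * normalDeriv Ω (fun z => φ z t) x ∂(surfaceMeasure Ω))
      - (∫ t in (0 : ℝ)..T, ∫ x, φ x t * normalDeriv Ω (fun z => y z t) x ∂(surfaceMeasure Ω))
      + (∫ x in Ω, ∫ t in (0 : ℝ)..T,
          y x t * (abcRight α T (φ x) t - Laplacian.laplacian (fun z => φ z t) x))
      - abNorm α / (1 - α) * (∫ x in Ω, ∫ t in (0 : ℝ)..T,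
          y x 0 * mittagLeffler α 1 (-(α / (1 - α)) * t ^ α) * φ x t)
      + abNorm α / (1 - α) * (∫ x in Ω, φ x T * ∫ t in (0 : ℝ)..T,
          y x t * mittagLeffler α 1 (-(α / (1 - α)) * (T - t) ^ α)) := by
  obtain ⟨Y⟩ := hΩ.nonempty_cylinderExtension hΩo hT hy
  obtain ⟨Φ⟩ := hΩ.nonempty_cylinderExtension hΩo hT hφ
  have hk := continuous_abKernel hα0
  change _ = _ - _ + _ - abNorm α / (1 - α) * (∫ x in Ω, ∫ t in (0 : ℝ)..T,
      y x 0 * abKernel α t * φ x t) + abNorm α / (1 - α) * (∫ x in Ω, φ x T *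
        ∫ t in (0 : ℝ)..T, y x t * abKernel α (T - t))
  set c := abNorm α / (1 - α)
  set k := abKernel α
  have hI : uIcc 0 T = Icc 0 T := uIcc_of_le hT.le
  have hYv := Y.continuous_val
  have hΦv := Φ.continuous_val
  have hYt := Y.continuous_dt
  have hΦt := Φ.continuous_dt
  have hYL := Y.continuous_lap
  have hΦL := Φ.continuous_lap
  -- the continuous integrands that replace the ones in the statement
  have hA : Continuous fun p : EuclideanSpace ℝ (Fin d) × ℝ =>
      (∫ τ in (0 : ℝ)..p.2, Y.dt (p.1, τ) * k (p.2 - τ)) * Φ.val p := by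
    refine Continuous.mul ?_ hΦv
    exact intervalIntegral.continuous_parametric_intervalIntegral_of_continuous
      (f := fun (p : EuclideanSpace ℝ (Fin d) × ℝ) τ => Y.dt (p.1, τ) * k (p.2 - τ))
      (by unfold Function.uncurry; fun_prop) continuous_snd
  have hB : Continuous fun p : EuclideanSpace ℝ (Fin d) × ℝ =>
      Y.val p * ∫ τ in p.2..T, Φ.dt (p.1, τ) * k (τ - p.2) := by
    refine hYv.mul ?_
    have := intervalIntegral.continuous_parametric_intervalIntegral_of_continuous (μ := volume)
      (a₀ := T)
      (f := fun (p : EuclideanSpace ℝ (Fin d) × ℝ) τ => Φ.dt (p.1, τ) * k (τ - p.2))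
      (by unfold Function.uncurry; fun_prop) continuous_snd
    exact this.neg.congr fun p => (intervalIntegral.integral_symm T p.2).symm
  have hP : Continuous fun p : EuclideanSpace ℝ (Fin d) × ℝ =>
      Y.val (p.1, 0) * k p.2 * Φ.val p := by fun_prop
  have hR : Continuous fun p : EuclideanSpace ℝ (Fin d) × ℝ =>
      Φ.val (p.1, T) * (Y.val p * k (T - p.2)) := by fun_prop
  have hyL : Continuous fun p => Y.val p * Φ.lap p := by fun_prop
  have hφL : Continuous fun p => Φ.val p * Y.lap p := by fun_prop
  have hvY : ∀ x ∈ Ω, ∀ t ∈ Icc 0 T, y x t = Y.val (x, t) := fun x hx =>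
    Y.val_eq x (subset_closure hx)
  have hvΦ : ∀ x ∈ Ω, ∀ t ∈ Icc 0 T, φ x t = Φ.val (x, t) := fun x hx =>
    Φ.val_eq x (subset_closure hx)
  have hslice : ∀ {G : EuclideanSpace ℝ (Fin d) × ℝ → ℝ}, Continuous G →
      ∀ x, IntervalIntegrable (fun t => G (x, t)) volume 0 T := fun hG x =>
    (hG.comp (by fun_prop : Continuous fun t : ℝ => (x, t))).intervalIntegrable _ _
  have hint : ∀ {G : EuclideanSpace ℝ (Fin d) × ℝ → ℝ}, Continuous G →
      IntegrableOn (fun x => ∫ t in (0 : ℝ)..T, G (x, t)) Ω := fun hG =>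
    integrableOn_intervalIntegral hΩb hG 0 T
  have hm := hΩo.measurableSet
  have h1 : (∫ x in Ω, ∫ t in (0 : ℝ)..T,
      (abcLeft α 0 (y x) t - Laplacian.laplacian (fun z => y z t) x) * φ x t) =
      c * (∫ x in Ω, ∫ t in (0 : ℝ)..T,
        (∫ τ in (0 : ℝ)..t, Y.dt (x, τ) * k (t - τ)) * Φ.val (x, t)) -
        ∫ x in Ω, ∫ t in (0 : ℝ)..T, Φ.val (x, t) * Y.lap (x, t) := by
    rw [← integral_const_mul, ← integral_sub ((hint hA).const_mul c) (hint hφL)]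
    refine setIntegral_congr_fun hm fun x hx => ?_
    rw [← intervalIntegral.integral_const_mul,
      ← intervalIntegral.integral_sub ((hslice hA x).const_mul c) (hslice hφL x)]
    refine intervalIntegral.integral_congr_Ioo_of_le hT.le fun t ht => ?_
    have htI := Ioo_subset_Icc_self ht
    rw [Y.abcLeft_eq α hx htI, Y.lap_eq x hx t ht, hvΦ x hx t htI]
    ring
  have h2 : (∫ x in Ω, ∫ t in (0 : ℝ)..T,
      y x t * (abcRight α T (φ x) t - Laplacian.laplacian (fun z => φ z t) x)) =
      -c * (∫ x in Ω, ∫ t in (0 : ℝ)..T,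
        Y.val (x, t) * ∫ τ in t..T, Φ.dt (x, τ) * k (τ - t)) -
        ∫ x in Ω, ∫ t in (0 : ℝ)..T, Y.val (x, t) * Φ.lap (x, t) := by
    rw [← integral_const_mul, ← integral_sub ((hint hB).const_mul (-c)) (hint hyL)]
    refine setIntegral_congr_fun hm fun x hx => ?_
    rw [← intervalIntegral.integral_const_mul,
      ← intervalIntegral.integral_sub ((hslice hB x).const_mul (-c)) (hslice hyL x)]
    refine intervalIntegral.integral_congr_Ioo_of_le hT.le fun t ht => ?_
    have htI := Ioo_subset_Icc_self ht
    rw [Φ.abcRight_eq α hx htI, Φ.lap_eq x hx t ht, hvY x hx t htI]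
    ring
  have h3 : (∫ x in Ω, ∫ t in (0 : ℝ)..T, y x 0 * k t * φ x t) =
      ∫ x in Ω, ∫ t in (0 : ℝ)..T, Y.val (x, 0) * k t * Φ.val (x, t) := by
    refine setIntegral_congr_fun hm fun x hx => intervalIntegral.integral_congr fun t ht => ?_
    rw [hI] at ht
    simp only [hvY x hx 0 ⟨le_rfl, hT.le⟩, hvΦ x hx t ht]
  have h4 : (∫ x in Ω, φ x T * ∫ t in (0 : ℝ)..T, y x t * k (T - t)) =
      ∫ x in Ω, ∫ t in (0 : ℝ)..T, Φ.val (x, T) * (Y.val (x, t) * k (T - t)) := by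
    refine setIntegral_congr_fun hm fun x hx => ?_
    rw [← intervalIntegral.integral_const_mul]
    refine intervalIntegral.integral_congr fun t ht => ?_
    rw [hI] at ht
    simp only [hvY x hx t ht, hvΦ x hx T ⟨hT.le, le_rfl⟩]
  have h5 : (∫ x in Ω, ∫ t in (0 : ℝ)..T,
      (∫ τ in (0 : ℝ)..t, Y.dt (x, τ) * k (t - τ)) * Φ.val (x, t)) =
      (∫ x in Ω, ∫ t in (0 : ℝ)..T, Φ.val (x, T) * (Y.val (x, t) * k (T - t))) -
      (∫ x in Ω, ∫ t in (0 : ℝ)..T, Y.val (x, 0) * k t * Φ.val (x, t)) -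
      ∫ x in Ω, ∫ t in (0 : ℝ)..T,
        Y.val (x, t) * ∫ τ in t..T, Φ.dt (x, τ) * k (τ - t) := by
    refine (setIntegral_congr_fun hm fun x hx => ?_).trans
      ((integral_sub ((hint hR).sub (hint hP)) (hint hB)).trans
        (congrArg (· - _) (integral_sub (hint hR) (hint hP))))
    simp only [Pi.sub_apply]
    rw [Y.integral_conv_dt_mul Φ hT.le hk hx, intervalIntegral.integral_const_mul]
  rw [h1, h2, h3, h4, h5, Y.green_second hΩo hΩb hΩ hT Φ]
  ring
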